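/- Let $k$ be an algebraically closed field and let $\mathcal C$ be a $k$-linear triangulated category with suspension functor $\Sigma$, which is Hom-finite (all spaces $\operatorname{Hom}_{\mathcal C}(X,Y)$ are finite-dimensional over $k$), has split idempotents, and is 2-Calabi–Yau, i.e. there are isomorphisms $\operatorname{Hom}_{\mathcal C}(X,Y)\cong \operatorname{Hom}_k(\operatorname{Hom}_{\mathcal C}(Y,\Sigma^2X),k)$ natural in $X$ and $Y$. Suppose that $\mathcal C$ has a cluster-tilting object $T$ (that is, $\operatorname{add}(T)=\{X:\operatorname{Hom}_{\mathcal C}(T,\Sigma X)=0\}=\{X:\operatorname{Hom}_{\mathcal C}(X,\Sigma T)=0\}$) whose endomorphism algebra $\Lambda=\operatorname{End}_{\mathcal C}(T)$ is symmetric, i.e. $\Lambda\cong\operatorname{Hom}_k(\Lambda,k)$ as $\Lambda$-$\Lambda$-bimodules. Consider the Auslander–Reiten quiver of $\mathcal C$: its vertices are the isomorphism classes of indecomposable objects, the number of arrows from $X$ to $Y$ is $\dim_k \operatorname{rad}(X,Y)/\operatorname{rad}^2(X,Y)$, and $\tau Y=X$ when there is an Auslander–Reiten triangle $X\to E\to Y\to\Sigma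 X$. Then: 1. the translation $\tau$ is defined at every vertex, and $\tau^2X\cong X$ for every indecomposable object $X$; 2. every connected component of the Auslander–Reiten quiver that is not finite is a stable tube of rank $1$ or $2$, i.e. is isomorphic as a translation quiver to $\mathbb ZA_\infty/\langle\tau^r\rangle$ with $r=1$ or $r=2$. In particular, if the Auslander–Reiten quiver of $\mathcal C$ has no finite component, it consists only of stable tubes of rank $1$ or $2$. -/

import Mathlib

open CategoryTheory CategoryTheory.Limits CategoryTheory.Pretriangulated

namespace ARTheory

universe w v u

/-! ### Symmetric algebras -/

/-- A finite-dimensional `k`-algebra `A` is symmetric if `A` and its dual `Hom_k(A, k)` are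
isomorphic as `A`-`A`-bimodules; the bimodule structure on the dual is
`(a • φ • b) y = φ (b * y * a)`. -/
def IsSymmetricAlgebra (k : Type w) [Field k] (A : Type v) [Ring A] [Algebra k A] : Prop :=
  Module.Finite k A ∧
    ∃ φ : A ≃ₗ[k] Module.Dual k A, ∀ a b x y : A, φ (a * x * b) y = φ x (b * y * a)

/-! ### The radical of a linear category -/

section Radical

variable {C : Type u} [Category.{v} C] [Preadditive C]

/-- A morphism `f : X ⟶ Y` is radical if `1 - g ∘ f` is invertible for all `g : Y ⟶ X`. -/
def IsRadical {X Y : C} (f : X ⟶ Y) : Prop :=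
  ∀ g : Y ⟶ X, IsIso (𝟙 X - f ≫ g)

lemma isIso_one_sub_swap {X Y : C} (a : X ⟶ Y) (b : Y ⟶ X) (h : IsIso (𝟙 X - a ≫ b)) :
    IsIso (𝟙 Y - b ≫ a) := by
  obtain ⟨c, h1, h2⟩ := h
  have e1 : a ≫ b ≫ c = c - 𝟙 X := by
    simp only [Preadditive.sub_comp, Category.id_comp, Category.assoc] at h1
    rw [← h1]; abel
  have e2 : c ≫ a ≫ b = c - 𝟙 X := by
    simp only [Preadditive.comp_sub, Category.comp_id] at h2
    rw [← h2]; abel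
  refine ⟨𝟙 Y + b ≫ c ≫ a, ?_, ?_⟩
  · have : b ≫ (a ≫ b ≫ c) ≫ a = b ≫ c ≫ a - b ≫ a := by rw [e1]; simp
    simp only [Category.assoc] at this
    simp only [Preadditive.sub_comp, Preadditive.comp_add, Category.id_comp, Category.comp_id,
      Category.assoc, this]
    abel
  · have : b ≫ (c ≫ a ≫ b) ≫ a = b ≫ c ≫ a - b ≫ a := by rw [e2]; simp
    simp only [Category.assoc] at this
    simp only [Preadditive.comp_sub, Preadditive.add_comp, Category.id_comp, Category.comp_id,
      Category.assoc, this]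
    abel

lemma IsRadical.precomp {W X Y : C} {f : X ⟶ Y} (hf : IsRadical f) (a : W ⟶ X) :
    IsRadical (a ≫ f) := by
  intro g
  have := isIso_one_sub_swap (f ≫ g) a (by simpa using hf (g ≫ a))
  simpa using this

lemma IsRadical.add {X Y : C} {f₁ f₂ : X ⟶ Y} (h₁ : IsRadical f₁) (h₂ : IsRadical f₂) :
    IsRadical (f₁ + f₂) := by
  intro g
  have hu := h₁ g
  have hv := h₂.precomp (inv (𝟙 X - f₁ ≫ g)) g
  have e : 𝟙 X - (f₁ + f₂) ≫ g =
      (𝟙 X - f₁ ≫ g) ≫ (𝟙 X - (inv (𝟙 X - f₁ ≫ g) ≫ f₂) ≫ g) := by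
    rw [Preadditive.comp_sub]
    simp only [Category.comp_id, Category.assoc, IsIso.hom_inv_id_assoc, Preadditive.add_comp]
    abel
  rw [e]
  infer_instance

variable (k : Type w) [Field k] [Linear k C]

/-- The radical `rad(X, Y)` as a subspace of `Hom(X, Y)`. -/
def rad (X Y : C) : Submodule k (X ⟶ Y) where
  carrier := {f | IsRadical f}
  add_mem' := IsRadical.add
  zero_mem' := fun g => by simpa using (inferInstance : IsIso (𝟙 X))
  smul_mem' := fun c f hf g => by
    have := hf (c • g)
    simpa using this

/-- The square `rad²(X, Y)` of the radical: finite sums of composites of two radical morphisms. -/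
def radSq (X Y : C) : Submodule k (X ⟶ Y) :=
  Submodule.span k
    {h | ∃ (Z : C) (f : X ⟶ Z) (g : Z ⟶ Y), IsRadical f ∧ IsRadical g ∧ h = f ≫ g}

/-- The dimension of the space of irreducible maps `rad(X, Y) / rad²(X, Y)`. -/
noncomputable def irrDim (X Y : C) : ℕ :=
  Module.finrank k (rad k X Y ⧸ (radSq k X Y).submoduleOf (rad k X Y))

end Radical

/-! ### Triangulated categories -/

section Triangulated

variable (k : Type w) [Field k] (C : Type u) [Category.{v} C] [Preadditive C] [Linear k C]
  [HasZeroObject C] [HasShift C ℤ] [∀ n : ℤ, (shiftFunctor C n).Additive] [Pretriangulated C]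

/-- `C` is Hom-finite over `k`. -/
def IsHomFinite : Prop := ∀ X Y : C, Module.Finite k (X ⟶ Y)

/-- `C` is 2-Calabi–Yau: there are isomorphisms `Hom(X, Y) ≅ D Hom(Y, X⟦2⟧)`,
natural in `X` and `Y`, where `D` is the `k`-dual; that is, the square of the suspension is a
Serre functor. -/
def IsTwoCalabiYau : Prop :=
  ∃ φ : ∀ X Y : C, (X ⟶ Y) ≃ₗ[k] Module.Dual k (Y ⟶ X⟦(2 : ℤ)⟧),
    ∀ {X X' Y Y' : C} (f : X' ⟶ X) (h : X ⟶ Y) (g : Y ⟶ Y') (t : Y' ⟶ X'⟦(2 : ℤ)⟧),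
      φ X' Y' (f ≫ h ≫ g) t = φ X Y h (g ≫ t ≫ f⟦(2 : ℤ)⟧')

variable {C}

/-- `X` lies in `add T`: it is a direct summand of a finite direct sum of copies of `T`. -/
def InAdd (T X : C) : Prop :=
  ∃ n : ℕ, Nonempty (Retract X (⨁ fun _ : Fin n => T))

/-- `T` is a cluster-tilting object: `add T` consists exactly of the objects `X` with
`Hom(T, X⟦1⟧) = 0`, and also exactly of the objects `X` with `Hom(X, T⟦1⟧) = 0`. -/
def IsClusterTilting (T : C) : Prop :=
  (∀ X : C, InAdd T X ↔ ∀ f : T ⟶ X⟦(1 : ℤ)⟧, f = 0) ∧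
    (∀ X : C, InAdd T X ↔ ∀ f : X ⟶ T⟦(1 : ℤ)⟧, f = 0)

/-- An Auslander–Reiten triangle: a distinguished triangle `X ⟶ E ⟶ Y ⟶ X⟦1⟧` with `X`, `Y`
indecomposable and nonzero third map, such that every morphism to `Y` which is not a split
epimorphism factors through `E ⟶ Y`. -/
structure IsARTriangle (Δ : Triangle C) : Prop where
  distinguished : Δ ∈ distTriang C
  indecomposable₁ : Indecomposable Δ.obj₁
  indecomposable₃ : Indecomposable Δ.obj₃
  ne_zero : Δ.mor₃ ≠ 0
  factors : ∀ (W : C) (f : W ⟶ Δ.obj₃), ¬ IsSplitEpi f → ∃ f' : W ⟶ Δ.obj₂, f' ≫ Δ.mor₂ = f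

variable (C)

/-- Vertices of the Auslander–Reiten quiver: isomorphism classes of indecomposable objects. -/
def ARVertex : Type u := {X : Skeleton C // Indecomposable ((fromSkeleton C).obj X)}

variable {C}

/-- The chosen representative of a vertex. -/
noncomputable def ARVertex.obj (x : ARVertex C) : C := (fromSkeleton C).obj x.1

/-- The number of arrows `x ⟶ y` in the Auslander–Reiten quiver. -/
noncomputable def arrows (x y : ARVertex C) : ℕ := irrDim k x.obj y.obj

/-- `x = τ y`: there is an Auslander–Reiten triangle from `x` to `y`. -/
def IsTranslate (x y : ARVertex C) : Prop :=
  ∃ Δ : Triangle C, IsARTriangle Δ ∧ Nonempty (Δ.obj₁ ≅ x.obj) ∧ Nonempty (Δ.obj₃ ≅ y.obj)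

/-- The connected component of the Auslander–Reiten quiver that contains `x`. -/
def component (x : ARVertex C) : Set (ARVertex C) :=
  {y | Relation.EqvGen (fun a b => arrows k a b ≠ 0) x y}

/-- The number of arrows in the translation quiver `ℤA_∞ / ⟨τ^r⟩` with vertex set
`ℕ × ℤ/r`: there is one arrow `(n, i) ⟶ (n + 1, i)` and one arrow `(n + 1, i) ⟶ (n, i + 1)`
for every `n` and `i`, and no other; the translation is `τ (n, i) = (n, i - 1)`. -/
def tubeArrows (r : ℕ) (p q : ℕ × ZMod r) : ℕ :=
  if (q.1 = p.1 + 1 ∧ q.2 = p.2) ∨ (p.1 = q.1 + 1 ∧ q.2 = p.2 + 1) then 1 else 0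

/-- The full translation subquiver of the Auslander–Reiten quiver on the vertex set `S` is a
stable tube of rank `r ≥ 1`: it is isomorphic to `ℤA_∞ / ⟨τ^r⟩` as a translation quiver. -/
def IsStableTube (r : ℕ) (S : Set (ARVertex C)) : Prop :=
  1 ≤ r ∧ ∃ e : ℕ × ZMod r ≃ S,
    (∀ p q, arrows k (e p).1 (e q).1 = tubeArrows r p q) ∧
    (∀ p q, IsTranslate (e p).1 (e q).1 ↔ p = (q.1, q.2 - 1))

end Triangulated

end ARTheory

/-! By Serre duality in a 2-Calabi–Yau category, AR triangles exist and τ is the suspension Σ. The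
symmetrizing form of `End T` is dual to a map T → Σ²T, which is an isomorphism commuting with all
endomorphisms of T. As every X is the cone of a map in add T, this yields X ≅ Σ²X, so τ² = 1 on
vertices (`IsClusterTilting.nonempty_iso_shift_two`).

Put d(X) = dim Hom(T, X) + dim Hom(ΣT, X). Because Σ² fixes objects up to isomorphism, Σ exchanges
the two summands and d is τ-invariant. It is positive on indecomposables because T is
cluster-tilting, and Hom(T ⊕ ΣT, -) applied to AR triangles makes it subadditive: the values at the
predecessors of x, counted with arrows, add up to at most 2 d(x) (`arQuiver`).

On an infinite component d is unbounded (`unbounded_of_infinite`). Otherwise the Harada–Sai lemma,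
which holds for Hom(T, -) because this functor is full onto its equivariant maps, makes Hom(T, y)
vanish for all y outside a finite set of vertices close to T. Applied to y and τy this contradicts
d(y) > 0.

The rest is combinatorics (`SubadditiveQuiver.exists_tube`). Unboundedness forces every vertex to
have a predecessor of larger value, and subadditivity then leaves room for at most one more arrow,
from a smaller vertex. Climbing from a vertex of minimal value gives a ray that, together with its
τ-translate, fills the component. Since τ² = 1 and τ fixes either all vertices of the ray or none,
the rank is 1 or 2. -/

namespace ARTheory

universe w v u

/-! ### Indecomposable objects of a Hom-finite category -/

section

/-- Fitting's lemma for a finite-dimensional algebra without nontrivial idempotents. -/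
lemma isUnit_or_isNilpotent_of_idempotents (k : Type w) [Field k] {A : Type v} [Ring A]
    [Algebra k A] [Module.Finite k A] (h : ∀ e : A, e * e = e → e = 0 ∨ e = 1) (f : A) :
    IsUnit f ∨ IsNilpotent f := by
  -- The extra factor X ensures n ≥ 1 below, so that a power of `f` can be split off as `f * f ^ (n
  -- - 1)`.
  have hne : Polynomial.X * minpoly k f ≠ 0 :=
    mul_ne_zero Polynomial.X_ne_zero (minpoly.ne_zero (Algebra.IsIntegral.isIntegral f))
  obtain ⟨q, hq, hq0⟩ :=
    Polynomial.exists_eq_pow_rootMultiplicity_mul_and_not_dvd _ hne 0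
  set n := (Polynomial.X * minpoly k f).rootMultiplicity 0
  rw [Polynomial.C_0, sub_zero] at hq hq0
  have hn : n ≠ 0 := by
    intro hn
    rw [hn, pow_zero, one_mul] at hq
    exact hq0 ⟨_, hq.symm⟩
  have hcop : IsCoprime (Polynomial.X ^ n) q :=
    ((Polynomial.irreducible_X.coprime_iff_not_dvd).2 hq0).pow_left
  obtain ⟨u, v, huv⟩ := hcop
  have hz : f ^ n * Polynomial.aeval f q = 0 := by
    have := congrArg (Polynomial.aeval f) hq
    simpa using this.symm
  have h1 : Polynomial.aeval f u * f ^ n + Polynomial.aeval f v * Polynomial.aeval f q = 1 := by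
    have := congrArg (Polynomial.aeval f) huv
    simpa using this
  have hc (p : Polynomial k) : Commute f (Polynomial.aeval f p) := by
    nth_rewrite 1 [← Polynomial.aeval_X (R := k) f]
    rw [Commute, SemiconjBy, ← map_mul, ← map_mul, mul_comm]
  have hz' : f ^ n * (Polynomial.aeval f v * Polynomial.aeval f q) = 0 := by
    rw [← mul_assoc, ((hc v).pow_left n).eq, mul_assoc, hz, mul_zero]
  have hidem : (Polynomial.aeval f u * f ^ n) * (Polynomial.aeval f u * f ^ n) =
      Polynomial.aeval f u * f ^ n := by
    conv_rhs => rw [← mul_one (Polynomial.aeval f u * f ^ n), ← h1, mul_add, mul_assoc _ _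
      (Polynomial.aeval f v * _), hz', mul_zero, add_zero]
  rcases h _ hidem with h0 | h0
  · right
    refine ⟨n, ?_⟩
    rw [h0, zero_add] at h1
    rwa [h1, mul_one] at hz'
  · left
    obtain ⟨m, hm⟩ : ∃ m, n = m + 1 := ⟨n - 1, by omega⟩
    rw [hm] at h0
    refine ⟨⟨f, Polynomial.aeval f u * f ^ m, ?_, ?_⟩, rfl⟩
    · rw [← mul_assoc, (hc u).eq, mul_assoc, ← pow_succ', h0]
    · rw [mul_assoc, ← pow_succ, h0]

/-! ### Krull–Schmidt theory: local endomorphism rings, radical maps and decompositions -/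

section KrullSchmidt

variable {C : Type u} [Category.{v} C] [Preadditive C]

/-- A morphism is radical iff all its composites with maps back are radical. -/
lemma isRadical_iff_forall_comp {X Y : C} (f : X ⟶ Y) :
    IsRadical f ↔ ∀ g : Y ⟶ X, IsRadical (f ≫ g) := by
  constructor
  · intro h g g'
    simpa using h (g ≫ g')
  · intro h g
    simpa using h g (𝟙 X)

lemma isRadical_iff_forall_comp' {X Y : C} (g : Y ⟶ X) :
    IsRadical g ↔ ∀ f : X ⟶ Y, IsRadical (f ≫ g) := by
  constructor
  · intro h f
    exact h.precomp f
  · intro h f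
    exact isIso_one_sub_swap _ _ (by simpa using h f (𝟙 X))

/-- Complementary retracts attached to an idempotent. -/
lemma exists_retracts_of_idempotent [IsIdempotentComplete C] {X : C} (e : X ⟶ X) (he : e ≫ e = e) :
    ∃ (Y Z : C) (i : Y ⟶ X) (p : X ⟶ Y) (j : Z ⟶ X) (q : X ⟶ Z),
      i ≫ p = 𝟙 Y ∧ j ≫ q = 𝟙 Z ∧ i ≫ q = 0 ∧ j ≫ p = 0 ∧ p ≫ i = e ∧ q ≫ j = 𝟙 X - e := by
  obtain ⟨Y, i, p, hip, hpi⟩ := IsIdempotentComplete.idempotents_split X e he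
  obtain ⟨Z, j, q, hjq, hqj⟩ := IsIdempotentComplete.idempotents_split X (𝟙 X - e)
    (Idempotents.idem_of_id_sub_idem e he)
  refine ⟨Y, Z, i, p, j, q, hip, hjq, ?_, ?_, hpi, hqj⟩
  · have : i ≫ ((p ≫ i) ≫ (q ≫ j)) ≫ q = 0 := by
      rw [hpi, hqj, Preadditive.comp_sub, he, Category.comp_id, sub_self, zero_comp, comp_zero]
    simpa [reassoc_of% hip, hjq] using this
  · have : j ≫ ((q ≫ j) ≫ (p ≫ i)) ≫ p = 0 := by
      rw [hpi, hqj, Preadditive.sub_comp, he, Category.id_comp, sub_self, zero_comp, comp_zero]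
    simpa [reassoc_of% hjq, hip] using this

variable [HasBinaryBiproducts C]

lemma _root_.CategoryTheory.Indecomposable.of_iso {X Y : C} (e : X ≅ Y)
    (h : Indecomposable X) : Indecomposable Y :=
  ⟨fun hY => h.1 (hY.of_iso e), fun A B i => h.2 A B (e ≪≫ i)⟩

lemma _root_.CategoryTheory.Indecomposable.id_ne_zero {X : C} (h : Indecomposable X) : 𝟙 X ≠ 0 :=
  fun h0 => h.1 ((IsZero.iff_id_eq_zero X).2 h0)

/-- A pair of complementary retracts gives a direct sum decomposition. -/
noncomputable def isoBiprodOfRetracts {X Y Z : C} (i : Y ⟶ X) (p : X ⟶ Y) (j : Z ⟶ X) (q : X ⟶ Z)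
    (hip : i ≫ p = 𝟙 Y) (hjq : j ≫ q = 𝟙 Z) (hiq : i ≫ q = 0) (hjp : j ≫ p = 0)
    (hsum : p ≫ i + q ≫ j = 𝟙 X) :
    X ≅ Y ⊞ Z where
  hom := biprod.lift p q
  inv := biprod.desc i j
  hom_inv_id := by rw [biprod.lift_desc, hsum]
  inv_hom_id := by
    apply biprod.hom_ext' <;> apply biprod.hom_ext <;> simp [hiq, hjp, hip, hjq]

lemma indecomposable_of_idempotent {X : C} (hX : 𝟙 X ≠ 0)
    (h : ∀ e : X ⟶ X, e ≫ e = e → e = 0 ∨ e = 𝟙 X) : Indecomposable X := by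
  refine ⟨fun h0 => hX (h0.eq_of_src _ _), fun Y Z i => ?_⟩
  rcases h (i.hom ≫ biprod.fst ≫ biprod.inl ≫ i.inv) (by simp) with h0 | h0
  · left
    rw [IsZero.iff_id_eq_zero]
    have := congrArg (fun f => biprod.inl ≫ i.inv ≫ f ≫ i.hom ≫ biprod.fst) h0
    simpa using this
  · right
    rw [IsZero.iff_id_eq_zero]
    have := congrArg (fun f => biprod.inr ≫ i.inv ≫ f ≫ i.hom ≫ biprod.snd) h0
    simpa using this.symm

variable [IsIdempotentComplete C]

lemma _root_.CategoryTheory.Indecomposable.idempotent_eq {X : C} (h : Indecomposable X) (e : X ⟶ X)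
    (he : e ≫ e = e) : e = 0 ∨ e = 𝟙 X := by
  obtain ⟨Y, Z, i, p, j, q, hip, hjq, hiq, hjp, hpi, hqj⟩ := exists_retracts_of_idempotent e he
  rcases h.2 Y Z (isoBiprodOfRetracts i p j q hip hjq hiq hjp (by rw [hpi, hqj]; abel)) with hY | hZ
  · left; rw [← hpi, hY.eq_of_tgt p 0, zero_comp]
  · right
    rw [hZ.eq_of_tgt q 0, zero_comp] at hqj
    exact (sub_eq_zero.1 hqj.symm).symm

/-- A split monomorphism between indecomposable objects is an isomorphism. -/
lemma _root_.CategoryTheory.Indecomposable.isIso_of_retract {X Y : C}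
    (hX : Indecomposable X) (hY : Indecomposable Y)
    {f : X ⟶ Y} {g : Y ⟶ X} (h : f ≫ g = 𝟙 X) : IsIso f ∧ IsIso g := by
  have : g ≫ f = 𝟙 Y := by
    refine (hY.idempotent_eq (g ≫ f) (by simp [reassoc_of% h])).resolve_left fun h0 => ?_
    apply hX.id_ne_zero
    have : f ≫ (g ≫ f) ≫ g = 𝟙 X := by simp [h]
    rw [← this, h0]; simp
  exact ⟨⟨g, h, this⟩, ⟨f, this, h⟩⟩

variable {k : Type w} [Field k] [Linear k C]

lemma _root_.CategoryTheory.Indecomposable.isIso_or_isIso_sub {X : C} (hX : Indecomposable X)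
    [Module.Finite k (X ⟶ X)] (f : X ⟶ X) : IsIso f ∨ IsIso (𝟙 X - f) := by
  have : Module.Finite k (End X) := ‹_›
  rcases isUnit_or_isNilpotent_of_idempotents k (A := End X) (fun e he => hX.idempotent_eq e he)
    f with h | h
  · exact Or.inl ((isUnit_iff_isIso f).1 h)
  · exact Or.inr ((isUnit_iff_isIso (𝟙 X - f)).1 h.isUnit_one_sub)

lemma _root_.CategoryTheory.Indecomposable.isIso_or_isIso_of_add {X : C} (hX : Indecomposable X)
    [Module.Finite k (X ⟶ X)] {f g : X ⟶ X} (h : IsIso (f + g)) : IsIso f ∨ IsIso g := by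
  rcases hX.isIso_or_isIso_sub (k := k) (f ≫ inv (f + g)) with h1 | h1
  · left
    have : f = (f ≫ inv (f + g)) ≫ (f + g) := by
      rw [Category.assoc, IsIso.inv_hom_id, Category.comp_id]
    rw [this]; infer_instance
  · right
    have : g = (𝟙 X - f ≫ inv (f + g)) ≫ (f + g) := by
      rw [Preadditive.sub_comp, Category.assoc, IsIso.inv_hom_id, Category.comp_id,
        Category.id_comp, add_sub_cancel_left]
    rw [this]; infer_instance

lemma _root_.CategoryTheory.Indecomposable.exists_isIso_of_sum {X : C} (hX : Indecomposable X)
    [Module.Finite k (X ⟶ X)] {ι : Type*} (s : Finset ι) (f : ι → (X ⟶ X))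
    (h : IsIso (∑ i ∈ s, f i)) : ∃ i ∈ s, IsIso (f i) := by
  classical
  induction s using Finset.induction_on with
  | empty =>
    exfalso
    rw [Finset.sum_empty] at h
    exact hX.id_ne_zero (by rw [← IsIso.hom_inv_id (0 : X ⟶ X), zero_comp])
  | insert a s ha ih =>
    rw [Finset.sum_insert ha] at h
    rcases hX.isIso_or_isIso_of_add (k := k) h with h1 | h1
    · exact ⟨a, by simp, h1⟩
    · obtain ⟨i, hi, h2⟩ := ih h1
      exact ⟨i, by simp [hi], h2⟩

lemma _root_.CategoryTheory.Indecomposable.isRadical_iff_not_isSplitMono {X Y : C}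
    (hX : Indecomposable X) [Module.Finite k (X ⟶ X)] (f : X ⟶ Y) : IsRadical f ↔ ¬ IsSplitMono f := by
  constructor
  · rintro h ⟨⟨s⟩⟩
    have := h s.retraction
    rw [s.id, sub_self] at this
    exact hX.id_ne_zero (by rw [← IsIso.hom_inv_id (0 : X ⟶ X), zero_comp])
  · intro h g
    refine (hX.isIso_or_isIso_sub (k := k) (f ≫ g)).resolve_left fun hi => h ?_
    exact ⟨⟨⟨g ≫ inv (f ≫ g), by rw [← Category.assoc, IsIso.hom_inv_id]⟩⟩⟩

lemma _root_.CategoryTheory.Indecomposable.isRadical_iff_not_isSplitEpi {X Y : C}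
    (hY : Indecomposable Y) [Module.Finite k (Y ⟶ Y)] (f : X ⟶ Y) : IsRadical f ↔ ¬ IsSplitEpi f := by
  constructor
  · rintro h ⟨⟨s⟩⟩
    have := isIso_one_sub_swap _ _ (h s.section_)
    rw [s.id, sub_self] at this
    exact hY.id_ne_zero (by rw [← IsIso.hom_inv_id (0 : Y ⟶ Y), zero_comp])
  · intro h g
    refine isIso_one_sub_swap g f
      ((hY.isIso_or_isIso_sub (k := k) (g ≫ f)).resolve_left fun hi => h ?_)
    exact ⟨⟨⟨inv (g ≫ f) ≫ g, by rw [Category.assoc, IsIso.inv_hom_id]⟩⟩⟩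

lemma _root_.CategoryTheory.Indecomposable.isRadical_iff_not_isIso {X Y : C} (hX : Indecomposable X)
    (hY : Indecomposable Y) [Module.Finite k (X ⟶ X)] (f : X ⟶ Y) :
    IsRadical f ↔ ¬ IsIso f := by
  rw [hX.isRadical_iff_not_isSplitMono (k := k), not_iff_not]
  constructor
  · rintro ⟨⟨s⟩⟩
    exact (hX.isIso_of_retract hY s.id).1
  · intro h; infer_instance

/-- Over an algebraically closed field, the radical of the endomorphism ring of an indecomposable
object is the kernel of a linear form. -/
lemma _root_.CategoryTheory.Indecomposable.exists_residue [IsAlgClosed k] {X : C}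
    (hX : Indecomposable X) [Module.Finite k (X ⟶ X)] :
    ∃ ε : (X ⟶ X) →ₗ[k] k, ε (𝟙 X) ≠ 0 ∧ ∀ f, ε f = 0 ↔ IsRadical f := by
  have hfin : Module.Finite k (End X) := ‹_›
  have : Nontrivial (End X) := ⟨⟨𝟙 X, 0, hX.id_ne_zero⟩⟩
  have h1 : 𝟙 X ∉ rad k X X := fun h =>
    (hX.isRadical_iff_not_isIso (k := k) hX (𝟙 X)).1 h inferInstance
  -- Any form that vanishes on the radical but not at the identity works: `f` has an eigenvalue c,
  -- so `c • 𝟙 X - f` is radical, and ε f = 0 forces c = 0.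
  obtain ⟨ε, hε, hker⟩ := Submodule.exists_le_ker_of_notMem h1
  refine ⟨ε, hε, fun f => ⟨fun h0 => ?_, fun h => hker h⟩⟩
  obtain ⟨c, hc⟩ := spectrum.nonempty_of_isAlgClosed_of_finiteDimensional k (End.of f)
  have hr : IsRadical (c • 𝟙 X - f) := by
    rw [hX.isRadical_iff_not_isIso (k := k) hX]
    intro hi
    rw [spectrum.mem_iff, Algebra.algebraMap_eq_smul_one] at hc
    exact hc ((isUnit_iff_isIso _).2 hi)
  have := hker (show c • 𝟙 X - f ∈ rad k X X from hr)
  rw [LinearMap.mem_ker, map_sub, h0, map_smul, sub_zero, smul_eq_zero] at this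
  rw [this.resolve_right hε, zero_smul, zero_sub] at hr
  have := (rad k X X).neg_mem (show -f ∈ rad k X X from hr)
  rwa [neg_neg] at this

/-- Every object is a finite direct sum of indecomposable objects. -/
lemma exists_indecomposable_decomposition (hfin : ∀ X Y : C, Module.Finite k (X ⟶ Y)) (X : C) :
    ∃ (ι : Type) (_ : Fintype ι) (Y : ι → C) (i : ∀ j, Y j ⟶ X) (p : ∀ j, X ⟶ Y j),
      (∀ j, Indecomposable (Y j)) ∧ (∀ j, i j ≫ p j = 𝟙 (Y j)) ∧
      (∀ j l, j ≠ l → i j ≫ p l = 0) ∧ ∑ j, p j ≫ i j = 𝟙 X := by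
  induction hn : Module.finrank k (X ⟶ X) using Nat.strong_induction_on generalizing X with
  | _ n ih =>
  by_cases h0 : 𝟙 X = 0
  · exact ⟨Empty, inferInstance, nofun, nofun, nofun, nofun, nofun, nofun, by simp [h0]⟩
  by_cases hX : Indecomposable X
  · exact ⟨Unit, inferInstance, fun _ => X, fun _ => 𝟙 X, fun _ => 𝟙 X, fun _ => hX,
      by simp, fun j l h => (h rfl).elim, by simp⟩
  obtain ⟨e, he, he0, he1⟩ : ∃ e : X ⟶ X, e ≫ e = e ∧ e ≠ 0 ∧ e ≠ 𝟙 X := by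
    by_contra! hcon
    exact hX (indecomposable_of_idempotent h0 fun e he => or_iff_not_imp_left.2 (hcon e he))
  -- Termination: End Y embeds in End X by f ↦ p ≫ f ≫ i, and if the image contained `𝟙 X` then p ≫
  -- i would be the identity.
  have key : ∀ (Y : C) (i : Y ⟶ X) (p : X ⟶ Y), i ≫ p = 𝟙 Y → p ≫ i ≠ 𝟙 X →
      Module.finrank k (Y ⟶ Y) < Module.finrank k (X ⟶ X) := by
    intro Y i p hip hne
    let φ : (Y ⟶ Y) →ₗ[k] (X ⟶ X) := (Linear.leftComp k X p).comp (Linear.rightComp k Y i)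
    have hφ : ∀ f, φ f = p ≫ f ≫ i := fun f => rfl
    have hinj : Function.Injective φ := by
      intro f g hfg
      rw [hφ, hφ] at hfg
      have := congrArg (fun h => i ≫ h ≫ p) hfg
      simpa [hip, reassoc_of% hip] using this
    have := hfin X X
    have := hfin Y Y
    refine lt_of_le_of_ne (LinearMap.finrank_le_finrank_of_injective hinj) fun heq => hne ?_
    obtain ⟨g, hg⟩ := (LinearMap.injective_iff_surjective_of_finrank_eq_finrank heq).1 hinj (𝟙 X)
    rw [hφ] at hg
    rw [← Category.comp_id (p ≫ i), ← hg, Category.assoc, reassoc_of% hip]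
  obtain ⟨Y, Z, i, p, j, q, hip, hjq, hiq, hjp, hpi, hqj⟩ := exists_retracts_of_idempotent e he
  obtain ⟨ι₁, _, Y₁, i₁, p₁, h₁, h₁', h₁o, h₁''⟩ := ih _
    (hn ▸ key Y i p hip (by rwa [hpi])) Y rfl
  obtain ⟨ι₂, _, Y₂, i₂, p₂, h₂, h₂', h₂o, h₂''⟩ := ih _
    (hn ▸ key Z j q hjq (by rw [hqj]; simpa using he0)) Z rfl
  refine ⟨ι₁ ⊕ ι₂, inferInstance, Sum.elim Y₁ Y₂,
    fun a => match a with | .inl a => i₁ a ≫ i | .inr a => i₂ a ≫ j,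
    fun a => match a with | .inl a => p ≫ p₁ a | .inr a => q ≫ p₂ a, ?_, ?_, ?_, ?_⟩
  · rintro (a | a)
    exacts [h₁ a, h₂ a]
  · rintro (a | a)
    · simp [reassoc_of% hip, h₁']
    · simp [reassoc_of% hjq, h₂']
  · rintro (a | a) (b | b) hab
    · change (i₁ a ≫ i) ≫ p ≫ p₁ b = 0
      simp [reassoc_of% hip, h₁o a b fun h => hab (by rw [h])]
    · change (i₁ a ≫ i) ≫ q ≫ p₂ b = 0
      simp [reassoc_of% hiq]
    · change (i₂ a ≫ j) ≫ p ≫ p₁ b = 0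
      simp [reassoc_of% hjp]
    · change (i₂ a ≫ j) ≫ q ≫ p₂ b = 0
      simp [reassoc_of% hjq, h₂o a b fun h => hab (by rw [h])]
  · rw [Fintype.sum_sum_type]
    have e1 : ∑ a, (p ≫ p₁ a) ≫ i₁ a ≫ i = p ≫ i := by
      have := congrArg (fun f => p ≫ f ≫ i) h₁''
      simpa [Preadditive.comp_sum, Preadditive.sum_comp] using this
    have e2 : ∑ a, (q ≫ p₂ a) ≫ i₂ a ≫ j = q ≫ j := by
      have := congrArg (fun f => q ≫ f ≫ j) h₂''
      simpa [Preadditive.comp_sum, Preadditive.sum_comp] using this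
    refine (congrArg₂ (· + ·) e1 e2).trans ?_
    rw [hpi, hqj]; abel

end KrullSchmidt

end

/-! ### Auslander–Reiten triangles -/

section

/-- The form embeds V modulo its kernel into the dual of W modulo the kernel on the other side. -/
lemma finrank_quotient_ker_le_flip {k V W : Type*} [Field k] [AddCommGroup V] [Module k V]
    [AddCommGroup W] [Module k W] [Module.Finite k V] [Module.Finite k W]
    (B : V →ₗ[k] W →ₗ[k] k) :
    Module.finrank k (V ⧸ LinearMap.ker B) ≤ Module.finrank k (W ⧸ LinearMap.ker B.flip) := by
  have h1 : LinearMap.range B ≤ (LinearMap.ker B.flip).dualAnnihilator := by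
    rintro _ ⟨v, rfl⟩
    rw [Submodule.mem_dualAnnihilator]
    intro w hw
    exact LinearMap.congr_fun (LinearMap.mem_ker.1 hw) v
  rw [B.quotKerEquivRange.finrank_eq]
  refine (Submodule.finrank_mono h1).trans ?_
  exact (Subspace.quotEquivAnnihilator (LinearMap.ker B.flip)).finrank_eq.ge

lemma finrank_quotient_ker_eq_flip {k V W : Type*} [Field k] [AddCommGroup V] [Module k V]
    [AddCommGroup W] [Module k W] [Module.Finite k V] [Module.Finite k W]
    (B : V →ₗ[k] W →ₗ[k] k) :
    Module.finrank k (V ⧸ LinearMap.ker B) = Module.finrank k (W ⧸ LinearMap.ker B.flip) :=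
  le_antisymm (finrank_quotient_ker_le_flip B) (finrank_quotient_ker_le_flip B.flip)

section

variable {k : Type w} [Field k] {C : Type u} [Category.{v} C] [Preadditive C] [Linear k C]

lemma IsRadical.postcomp {X Y Z : C} {f : X ⟶ Y} (hf : IsRadical f) (g : Y ⟶ Z) :
    IsRadical (f ≫ g) := fun a => by simpa using hf (g ≫ a)

/-- The space of maps modulo radical maps has the same dimension in both directions. -/
lemma finrank_quotient_rad_symm [IsAlgClosed k] [HasBinaryBiproducts C] [IsIdempotentComplete C]
    (hfin : IsHomFinite k C) {Y : C} (hY : Indecomposable Y) (E : C) :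
    Module.finrank k ((Y ⟶ E) ⧸ rad k Y E) = Module.finrank k ((E ⟶ Y) ⧸ rad k E Y) := by
  have := hfin Y Y
  have := hfin Y E
  have := hfin E Y
  obtain ⟨ε, hε1, hε⟩ := hY.exists_residue (k := k)
  -- The residue of a composite pairs the two Hom spaces, and its kernel on either side is the
  -- radical.
  let B : (Y ⟶ E) →ₗ[k] (E ⟶ Y) →ₗ[k] k := (Linear.comp Y E Y).compr₂ ε
  have hB : ∀ f g, B f g = ε (f ≫ g) := fun f g => rfl
  have h1 : LinearMap.ker B = rad k Y E := by
    ext f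
    change B f = 0 ↔ IsRadical f
    rw [isRadical_iff_forall_comp, LinearMap.ext_iff]
    simp only [hB, hε, LinearMap.zero_apply]
  have h2 : LinearMap.ker B.flip = rad k E Y := by
    ext f
    change B.flip f = 0 ↔ IsRadical f
    rw [isRadical_iff_forall_comp', LinearMap.ext_iff]
    simp only [LinearMap.flip_apply, hB, hε, LinearMap.zero_apply]
  rw [← h1, ← h2]
  exact finrank_quotient_ker_eq_flip B

end

variable {k : Type w} [Field k] {C : Type u} [Category.{v} C] [Preadditive C] [Linear k C]
  [HasZeroObject C] [HasShift C ℤ] [∀ n : ℤ, (shiftFunctor C n).Additive] [Pretriangulated C]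

lemma IsARTriangle.not_isSplitEpi {Δ : Triangle C} (h : IsARTriangle Δ) :
    ¬ IsSplitEpi Δ.mor₂ := fun _ =>
  h.ne_zero (Δ.mor₃_eq_zero_of_epi₂ h.distinguished inferInstance)

lemma IsARTriangle.not_isSplitMono {Δ : Triangle C} (h : IsARTriangle Δ) :
    ¬ IsSplitMono Δ.mor₁ := fun _ =>
  h.ne_zero (Δ.mor₃_eq_zero_of_mono₁ h.distinguished inferInstance)

/-- Since `Δ.mor₂` followed by an isomorphism is not a split epimorphism, it factors through
`Δ'.mor₂`; the resulting square extends to a morphism of triangles. -/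
lemma IsARTriangle.exists_comparison {Δ Δ' : Triangle C} (h : IsARTriangle Δ)
    (h' : IsARTriangle Δ') (e : Δ.obj₃ ≅ Δ'.obj₃) :
    ∃ a : Δ.obj₁ ⟶ Δ'.obj₁, Δ.mor₃ ≫ a⟦(1 : ℤ)⟧' = e.hom ≫ Δ'.mor₃ := by
  have hne : ¬ IsSplitEpi (Δ.mor₂ ≫ e.hom) := by
    rintro ⟨⟨s⟩⟩
    refine h.not_isSplitEpi ⟨⟨⟨e.hom ≫ s.section_, ?_⟩⟩⟩
    have := s.id
    rw [← cancel_mono e.hom, Category.assoc, Category.assoc, this]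
    simp
  obtain ⟨f, hf⟩ := h'.factors _ _ hne
  obtain ⟨a, -, ha⟩ := complete_distinguished_triangle_morphism₁ Δ Δ' h.distinguished
    h'.distinguished f e.hom hf.symm
  exact ⟨a, ha⟩

variable [IsIdempotentComplete C]

/-- The endomorphism ring is local: otherwise `𝟙 - f` is invertible, yet its suspension annihilates
`Δ.mor₃`. -/
lemma IsARTriangle.isIso_of_comp_eq (hfin : IsHomFinite k C) {Δ : Triangle C}
    (h : IsARTriangle Δ) (f : Δ.obj₁ ⟶ Δ.obj₁) (hf : Δ.mor₃ ≫ f⟦(1 : ℤ)⟧' = Δ.mor₃) :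
    IsIso f := by
  have := hfin Δ.obj₁ Δ.obj₁
  refine (h.indecomposable₁.isIso_or_isIso_sub (k := k) f).resolve_right fun hi => h.ne_zero ?_
  rw [← cancel_mono ((𝟙 Δ.obj₁ - f)⟦(1 : ℤ)⟧'), Functor.map_sub, Preadditive.comp_sub, hf]
  simp

/-- The first map of an Auslander–Reiten triangle is left almost split. -/
lemma IsARTriangle.factors_left (hfin : IsHomFinite k C) {Δ : Triangle C} (h : IsARTriangle Δ)
    {W : C} (f : Δ.obj₁ ⟶ W) (hf : ¬ IsSplitMono f) : ∃ f' : Δ.obj₂ ⟶ W, Δ.mor₁ ≫ f' = f := by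
  by_cases h0 : Δ.mor₃ ≫ f⟦(1 : ℤ)⟧' = 0
  · obtain ⟨b, hb, -⟩ := complete_distinguished_triangle_morphism₂ Δ _ h.distinguished
      (contractible_distinguished W) f 0 (h0.trans zero_comp.symm)
    exact ⟨b, hb.trans (Category.comp_id f)⟩
  -- If `f` does not extend, push the triangle out along `f`. The new `g` is not a split
  -- epimorphism, so the pushout maps back to Δ by some a, and f ≫ a fixes `Δ.mor₃`. Thus f ≫ a is
  -- invertible and `f` splits.
  · obtain ⟨E, i, g, hE⟩ := distinguished_cocone_triangle₂ (Δ.mor₃ ≫ f⟦(1 : ℤ)⟧')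
    have hg : ¬ IsSplitEpi g := fun _ =>
      h0 ((Triangle.mk i g (Δ.mor₃ ≫ f⟦(1 : ℤ)⟧')).mor₃_eq_zero_of_epi₂ hE
        (inferInstanceAs (Epi g)))
    obtain ⟨g', hg'⟩ := h.factors E g hg
    obtain ⟨a, ha⟩ : ∃ a : W ⟶ Δ.obj₁, (Δ.mor₃ ≫ f⟦(1 : ℤ)⟧') ≫ a⟦(1 : ℤ)⟧' = Δ.mor₃ := by
      obtain ⟨a, -, ha⟩ := complete_distinguished_triangle_morphism₁ _ Δ hE h.distinguished g'
        (𝟙 Δ.obj₃) ((Category.comp_id g).trans hg'.symm)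
      exact ⟨a, ha.trans (Category.id_comp _)⟩
    have ha' : Δ.mor₃ ≫ (f ≫ a)⟦(1 : ℤ)⟧' = Δ.mor₃ := by
      rw [Functor.map_comp, ← Category.assoc, ha]
    have := h.isIso_of_comp_eq hfin _ ha'
    exact (hf ⟨⟨⟨a ≫ inv (f ≫ a), by rw [← Category.assoc, IsIso.hom_inv_id]⟩⟩⟩).elim

/-- An Auslander–Reiten triangle is determined by its last term. -/
lemma IsARTriangle.nonempty_iso₁ (hfin : IsHomFinite k C) {Δ Δ' : Triangle C}
    (h : IsARTriangle Δ) (h' : IsARTriangle Δ') (e : Δ.obj₃ ≅ Δ'.obj₃) :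
    Nonempty (Δ.obj₁ ≅ Δ'.obj₁) := by
  obtain ⟨a, ha⟩ := h.exists_comparison h' e
  obtain ⟨b, hb⟩ := h'.exists_comparison h e.symm
  have := h.isIso_of_comp_eq hfin (a ≫ b) (by
    rw [Functor.map_comp, ← Category.assoc, ha, Category.assoc, hb]; simp)
  have hr : a ≫ b ≫ inv (a ≫ b) = 𝟙 _ := by rw [← Category.assoc, IsIso.hom_inv_id]
  have := (h.indecomposable₁.isIso_of_retract h'.indecomposable₁ hr).1
  exact ⟨asIso a⟩

lemma IsARTriangle.isRadical₁ (hfin : IsHomFinite k C) {Δ : Triangle C} (h : IsARTriangle Δ) :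
    IsRadical Δ.mor₁ := by
  have := hfin Δ.obj₁ Δ.obj₁
  exact (h.indecomposable₁.isRadical_iff_not_isSplitMono (k := k) _).2 h.not_isSplitMono

lemma IsARTriangle.isRadical₂ (hfin : IsHomFinite k C) {Δ : Triangle C} (h : IsARTriangle Δ) :
    IsRadical Δ.mor₂ := by
  have := hfin Δ.obj₃ Δ.obj₃
  exact (h.indecomposable₃.isRadical_iff_not_isSplitEpi (k := k) _).2 h.not_isSplitEpi

/-- Irreducible maps ending in the last term of an Auslander–Reiten triangle. -/
lemma IsARTriangle.irrDim_obj₃ (hfin : IsHomFinite k C) {Δ : Triangle C} (h : IsARTriangle Δ)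
    (Y : C) : irrDim k Y Δ.obj₃ = Module.finrank k ((Y ⟶ Δ.obj₂) ⧸ rad k Y Δ.obj₂) := by
  have := hfin Δ.obj₃ Δ.obj₃
  have hrad := h.isRadical₂ hfin
  let ψ : (Y ⟶ Δ.obj₂) →ₗ[k] rad k Y Δ.obj₃ :=
    (Linear.rightComp k Y Δ.mor₂).codRestrict _ (fun f => hrad.precomp f)
  let π := (((radSq k Y Δ.obj₃).submoduleOf (rad k Y Δ.obj₃)).mkQ).comp ψ
  have hsurj : Function.Surjective π := by
    refine (Submodule.mkQ_surjective _).comp ?_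
    rintro ⟨f, hf⟩
    obtain ⟨f', hf'⟩ := h.factors Y f
      ((h.indecomposable₃.isRadical_iff_not_isSplitEpi (k := k) f).1 hf)
    exact ⟨f', Subtype.ext hf'⟩
  have hker : LinearMap.ker π = rad k Y Δ.obj₂ := by
    ext f
    have h1 : f ∈ LinearMap.ker π ↔ f ≫ Δ.mor₂ ∈ radSq k Y Δ.obj₃ := by
      rw [LinearMap.mem_ker, LinearMap.comp_apply, Submodule.mkQ_apply,
        Submodule.Quotient.mk_eq_zero]
      rfl
    rw [h1]
    constructor
    · intro hf
      -- Elements of rad² have radical lifts, and two lifts differ by a map through the radical map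
      -- `Δ.mor₁`. Hence every lift is radical.
      have key : ∀ x ∈ radSq k Y Δ.obj₃, ∃ g ∈ rad k Y Δ.obj₂, g ≫ Δ.mor₂ = x := by
        intro x hx
        induction hx using Submodule.span_induction with
        | mem x hx =>
          obtain ⟨Z, a, b, ha, hb, rfl⟩ := hx
          obtain ⟨b', hb'⟩ := h.factors Z b
            ((h.indecomposable₃.isRadical_iff_not_isSplitEpi (k := k) b).1 hb)
          exact ⟨a ≫ b', ha.postcomp b', by rw [Category.assoc, hb']⟩
        | zero => exact ⟨0, Submodule.zero_mem _, zero_comp⟩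
        | add x y _ _ hx hy =>
          obtain ⟨a, ha, rfl⟩ := hx
          obtain ⟨b, hb, rfl⟩ := hy
          exact ⟨a + b, Submodule.add_mem _ ha hb, Preadditive.add_comp _ _ _ _ _ _⟩
        | smul c x _ hx =>
          obtain ⟨a, ha, rfl⟩ := hx
          exact ⟨c • a, Submodule.smul_mem _ c ha, Linear.smul_comp _ _ _ _ _ _⟩
      obtain ⟨g, hg, hgf⟩ := key _ hf
      obtain ⟨t, ht⟩ := Δ.coyoneda_exact₂ h.distinguished (f - g)
        (by rw [Preadditive.sub_comp, hgf, sub_self])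
      have : f = t ≫ Δ.mor₁ + g := by rw [← ht]; abel
      rw [this]
      exact Submodule.add_mem _ ((h.isRadical₁ hfin).precomp t) hg
    · intro hf
      exact Submodule.subset_span ⟨_, f, Δ.mor₂, hf, hrad, rfl⟩
  exact (((Submodule.quotEquivOfEq _ _ hker.symm).trans
    (π.quotKerEquivOfSurjective hsurj)).finrank_eq).symm

/-- Irreducible maps starting in the first term of an Auslander–Reiten triangle. -/
lemma IsARTriangle.irrDim_obj₁ (hfin : IsHomFinite k C) {Δ : Triangle C} (h : IsARTriangle Δ)
    (Y : C) : irrDim k Δ.obj₁ Y = Module.finrank k ((Δ.obj₂ ⟶ Y) ⧸ rad k Δ.obj₂ Y) := by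
  have := hfin Δ.obj₁ Δ.obj₁
  have hrad := h.isRadical₁ hfin
  let ψ : (Δ.obj₂ ⟶ Y) →ₗ[k] rad k Δ.obj₁ Y :=
    (Linear.leftComp k Y Δ.mor₁).codRestrict _ (fun f => hrad.postcomp f)
  let π := (((radSq k Δ.obj₁ Y).submoduleOf (rad k Δ.obj₁ Y)).mkQ).comp ψ
  have hsurj : Function.Surjective π := by
    refine (Submodule.mkQ_surjective _).comp ?_
    rintro ⟨f, hf⟩
    obtain ⟨f', hf'⟩ := h.factors_left hfin f
      ((h.indecomposable₁.isRadical_iff_not_isSplitMono (k := k) f).1 hf)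
    exact ⟨f', Subtype.ext hf'⟩
  have hker : LinearMap.ker π = rad k Δ.obj₂ Y := by
    ext f
    have h1 : f ∈ LinearMap.ker π ↔ Δ.mor₁ ≫ f ∈ radSq k Δ.obj₁ Y := by
      rw [LinearMap.mem_ker, LinearMap.comp_apply, Submodule.mkQ_apply,
        Submodule.Quotient.mk_eq_zero]
      rfl
    rw [h1]
    constructor
    · intro hf
      have key : ∀ x ∈ radSq k Δ.obj₁ Y, ∃ g ∈ rad k Δ.obj₂ Y, Δ.mor₁ ≫ g = x := by
        intro x hx
        induction hx using Submodule.span_induction with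
        | mem x hx =>
          obtain ⟨Z, a, b, ha, hb, rfl⟩ := hx
          obtain ⟨a', ha'⟩ := h.factors_left hfin a
            ((h.indecomposable₁.isRadical_iff_not_isSplitMono (k := k) a).1 ha)
          exact ⟨a' ≫ b, hb.precomp a', by rw [← Category.assoc, ha']⟩
        | zero => exact ⟨0, Submodule.zero_mem _, comp_zero⟩
        | add x y _ _ hx hy =>
          obtain ⟨a, ha, rfl⟩ := hx
          obtain ⟨b, hb, rfl⟩ := hy
          exact ⟨a + b, Submodule.add_mem _ ha hb, Preadditive.comp_add _ _ _ _ _ _⟩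
        | smul c x _ hx =>
          obtain ⟨a, ha, rfl⟩ := hx
          exact ⟨c • a, Submodule.smul_mem _ c ha, Linear.comp_smul _ _ _ _ _ _⟩
      obtain ⟨g, hg, hgf⟩ := key _ hf
      obtain ⟨t, ht⟩ := Δ.yoneda_exact₂ h.distinguished (f - g)
        (by rw [Preadditive.comp_sub, hgf, sub_self])
      have : f = Δ.mor₂ ≫ t + g := by rw [← ht]; abel
      rw [this]
      exact Submodule.add_mem _ ((h.isRadical₂ hfin).postcomp t) hg
    · intro hf
      exact Submodule.subset_span ⟨_, Δ.mor₁, f, hrad, hf, rfl⟩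
  exact (((Submodule.quotEquivOfEq _ _ hker.symm).trans
    (π.quotKerEquivOfSurjective hsurj)).finrank_eq).symm

/-- Both numbers measure maps modulo radical maps between `Y` and the middle term, in opposite
directions. This is the symmetry of meshes. -/
lemma IsARTriangle.irrDim_eq [IsAlgClosed k] (hfin : IsHomFinite k C) {Δ : Triangle C}
    (h : IsARTriangle Δ) {Y : C} (hY : Indecomposable Y) :
    irrDim k Y Δ.obj₃ = irrDim k Δ.obj₁ Y := by
  rw [h.irrDim_obj₃ hfin, h.irrDim_obj₁ hfin, finrank_quotient_rad_symm hfin hY]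

/-- The suspension of an indecomposable object is indecomposable. -/
lemma _root_.CategoryTheory.Indecomposable.shift {X : C} (hX : Indecomposable X) (n : ℤ) :
    Indecomposable (X⟦n⟧) := by
  refine indecomposable_of_idempotent (fun h0 => hX.id_ne_zero ?_) fun e he => ?_
  · apply (shiftFunctor C n).map_injective
    rw [CategoryTheory.Functor.map_id, h0, Functor.map_zero]
  · obtain ⟨f, rfl⟩ := (shiftFunctor C n).map_surjective e
    rw [← Functor.map_comp] at he
    rcases hX.idempotent_eq f ((shiftFunctor C n).map_injective he) with rfl | rfl
    · left; simp
    · right; simp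

/-- In a 2-Calabi–Yau category the Auslander–Reiten translation is the suspension. -/
lemma exists_isARTriangle [IsAlgClosed k] (hfin : IsHomFinite k C) (hCY : IsTwoCalabiYau k C)
    {X X' : C} (hX : Indecomposable X) (e : X⟦(1 : ℤ)⟧ ≅ X') :
    ∃ (E : C) (f : X' ⟶ E) (g : E ⟶ X) (h : X ⟶ X'⟦(1 : ℤ)⟧),
      IsARTriangle (Triangle.mk f g h) := by
  obtain ⟨φ, hφ⟩ := hCY
  have := hfin X X
  have := hfin X (X⟦(2 : ℤ)⟧)
  obtain ⟨ε, hε1, hε⟩ := hX.exists_residue (k := k)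
  -- The connecting map is the Serre dual of the residue form. A map `a` into X that is not a split
  -- epimorphism kills `t`, since every composite h ≫ a is radical and so has residue zero.
  obtain ⟨t, ht⟩ : ∃ t : X ⟶ X⟦(2 : ℤ)⟧, ∀ h, φ X X h t = ε h := by
    let ev := Module.evalEquiv k (X ⟶ X⟦(2 : ℤ)⟧)
    refine ⟨ev.symm (ε.comp (φ X X).symm.toLinearMap), fun h => ?_⟩
    simp [ev]
  have ht0 : t ≠ 0 := by
    rintro rfl
    exact hε1 (by rw [← ht, map_zero])
  let α : X⟦(2 : ℤ)⟧ ≅ X'⟦(1 : ℤ)⟧ :=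
    (shiftFunctorAdd' C (1 : ℤ) 1 2 (by norm_num)).app X ≪≫ (shiftFunctor C (1 : ℤ)).mapIso e
  obtain ⟨E, f, g, hE⟩ := distinguished_cocone_triangle₂ (t ≫ α.hom)
  refine ⟨E, f, g, t ≫ α.hom, hE, (hX.shift 1).of_iso e, hX, ?_, fun W a ha => ?_⟩
  · intro h0
    apply ht0
    rw [← cancel_mono α.hom]
    exact h0.trans zero_comp.symm
  · change W ⟶ X at a
    have := hfin W (X⟦(2 : ℤ)⟧)
    have hat : a ≫ t = 0 := by
      rw [← Module.forall_dual_apply_eq_zero_iff k]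
      intro F
      obtain ⟨h, rfl⟩ := (φ X W).surjective F
      have h1 := hφ (𝟙 X) h a t
      simp only [CategoryTheory.Functor.map_id, Category.comp_id, Category.id_comp] at h1
      rw [← h1, ht, hε]
      exact ((hX.isRadical_iff_not_isSplitEpi (k := k) a).2 ha).precomp h
    obtain ⟨a', ha'⟩ := (Triangle.mk f g (t ≫ α.hom)).coyoneda_exact₃ hE a
      (show a ≫ t ≫ α.hom = 0 by rw [← Category.assoc, hat, zero_comp])
    exact ⟨a', ha'.symm⟩

end

/-! ### Cluster-tilting objects -/

section

section

variable (k : Type w) [Field k] {C : Type u} [Category.{v} C] [Preadditive C] [Linear k C]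
  [HasShift C ℤ]

/-- The dimension of `Hom(T ⊕ T⟦1⟧, X)`. -/
noncomputable def totalDim (T X : C) : ℕ :=
  Module.finrank k (T ⟶ X) + Module.finrank k (T⟦(1 : ℤ)⟧ ⟶ X)

variable {k}

lemma totalDim_congr (T : C) {X Y : C} (e : X ≅ Y) : totalDim k T X = totalDim k T Y := by
  rw [totalDim, totalDim, (Linear.homCongr k (Iso.refl T) e).finrank_eq,
    (Linear.homCongr k (Iso.refl (T⟦(1 : ℤ)⟧)) e).finrank_eq]

end

/-! ### Objects of add T, presentations, and fullness of Hom(T, -) -/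

section

variable {C : Type u} [Category.{v} C] [Preadditive C]
  [HasZeroObject C] [HasShift C ℤ] [∀ n : ℤ, (shiftFunctor C n).Additive] [Pretriangulated C]

/-- This form lets identities checked on `T` be transported to all of add T by finite sums. -/
lemma inAdd_iff (T X : C) : InAdd T X ↔
    ∃ (n : ℕ) (a : Fin n → (X ⟶ T)) (b : Fin n → (T ⟶ X)), ∑ j, a j ≫ b j = 𝟙 X := by
  constructor
  · rintro ⟨n, ⟨r⟩⟩
    refine ⟨n, fun j => r.i ≫ biproduct.π _ j,
      fun j => biproduct.ι (fun _ : Fin n => T) j ≫ r.r, ?_⟩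
    calc _ = r.i ≫ (∑ j, biproduct.π (fun _ : Fin n => T) j ≫
          biproduct.ι (fun _ : Fin n => T) j) ≫ r.r := by
          simp only [Preadditive.comp_sum, Preadditive.sum_comp, Category.assoc]
      _ = 𝟙 X := by rw [biproduct.total, Category.id_comp, r.retract]
  · rintro ⟨n, a, b, h⟩
    exact ⟨n, ⟨⟨biproduct.lift a, biproduct.desc b, by rw [biproduct.lift_desc, h]⟩⟩⟩

lemma inAdd_self (T : C) : InAdd T T :=
  (inAdd_iff T T).2 ⟨1, fun _ => 𝟙 T, fun _ => 𝟙 T, by simp⟩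

lemma inAdd_biproduct (T : C) (n : ℕ) : InAdd T (⨁ fun _ : Fin n => T) :=
  ⟨n, ⟨Retract.refl _⟩⟩

lemma IsClusterTilting.hom_shift_eq_zero {T M : C} (hT : IsClusterTilting T) (hM : InAdd T M)
    (f : T ⟶ M⟦(1 : ℤ)⟧) : f = 0 := (hT.1 M).1 hM f

/-- The fibre of an `add T`-precover lies in `add T`. -/
lemma IsClusterTilting.inAdd_fiber {T : C} (hT : IsClusterTilting T) {Δ : Triangle C}
    (hΔ : Δ ∈ distTriang C) (h₂ : InAdd T Δ.obj₂)
    (hsurj : ∀ f : T ⟶ Δ.obj₃, ∃ g : T ⟶ Δ.obj₂, g ≫ Δ.mor₂ = f) : InAdd T Δ.obj₁ := by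
  rw [hT.1]
  -- As Hom(T, -) vanishes on the suspension of the middle term, `b` comes from a map to the third
  -- term; that map lifts to the middle term, so `b` is zero.
  intro b
  obtain ⟨g, rfl⟩ := Δ.coyoneda_exact₁ hΔ b (hT.hom_shift_eq_zero h₂ _)
  obtain ⟨g', rfl⟩ := hsurj g
  rw [Category.assoc, comp_distTriang_mor_zero₂₃ _ hΔ, comp_zero]

variable {k : Type w} [Field k] [Linear k C]

/-- Every object has a presentation by objects of `add T`. -/
lemma IsClusterTilting.exists_presentation (hfin : IsHomFinite k C) {T : C}
    (hT : IsClusterTilting T) (X : C) :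
    ∃ (T₁ T₀ : C) (u : T₁ ⟶ T₀) (p : T₀ ⟶ X) (q : X ⟶ T₁⟦(1 : ℤ)⟧),
      Triangle.mk u p q ∈ distTriang C ∧ InAdd T T₁ ∧ InAdd T T₀ ∧
      ∀ f : T ⟶ X, ∃ g : T ⟶ T₀, g ≫ p = f := by
  have := hfin T X
  let B := Module.finBasis k (T ⟶ X)
  let p : (⨁ fun _ : Fin (Module.finrank k (T ⟶ X)) => T) ⟶ X := biproduct.desc fun j => B j
  have hp : ∀ f : T ⟶ X, ∃ g, g ≫ p = f := fun f =>
    ⟨biproduct.lift fun j => B.repr f j • 𝟙 T, by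
      rw [biproduct.lift_desc]
      simp⟩
  obtain ⟨T₁, u, q, hΔ⟩ := distinguished_cocone_triangle₁ p
  exact ⟨T₁, _, u, p, q, hΔ, hT.inAdd_fiber hΔ (inAdd_biproduct T _) hp, inAdd_biproduct T _, hp⟩

/-- The functor `Hom(T, -)` is full onto modules over the endomorphism algebra of `T`. -/
lemma IsClusterTilting.exists_hom_of_equivariant (hfin : IsHomFinite k C) {T : C}
    (hT : IsClusterTilting T) {X Y : C} (α : (T ⟶ X) →ₗ[k] (T ⟶ Y))
    (hα : ∀ (a : T ⟶ T) (f : T ⟶ X), α (a ≫ f) = a ≫ α f) :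
    ∃ g : X ⟶ Y, ∀ f, α f = f ≫ g := by
  obtain ⟨T₁, T₀, u, p, q, hΔ, h₁, h₀, hp⟩ := hT.exists_presentation hfin X
  obtain ⟨n, a, b, hab⟩ := (inAdd_iff _ _).1 h₀
  obtain ⟨m, a', b', hab'⟩ := (inAdd_iff _ _).1 h₁
  -- On maps from `T`, composition with `r` is f ↦ α (f ≫ p). So `r` vanishes on `T₁`, which lies in
  -- add T, and descends along `p` to the required map.
  let r : T₀ ⟶ Y := ∑ j, a j ≫ α (b j ≫ p)
  have hr : ∀ f : T ⟶ T₀, f ≫ r = α (f ≫ p) := by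
    intro f
    have : f ≫ p = ∑ j, (f ≫ a j) ≫ b j ≫ p := by
      have := congrArg (fun g => f ≫ g ≫ p) hab
      simpa [Preadditive.comp_sum, Preadditive.sum_comp] using this.symm
    rw [this, map_sum, Preadditive.comp_sum]
    exact Finset.sum_congr rfl fun j _ => by rw [hα, Category.assoc]
  have hup : u ≫ p = 0 := comp_distTriang_mor_zero₁₂ _ hΔ
  have hur : u ≫ r = 0 := by
    rw [← Category.id_comp u, ← hab', Preadditive.sum_comp, Preadditive.sum_comp]
    refine Finset.sum_eq_zero fun j _ => ?_
    have := hr (b' j ≫ u)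
    rw [Category.assoc, Category.assoc, hup, comp_zero, map_zero] at this
    rw [Category.assoc, Category.assoc, this, comp_zero]
  obtain ⟨g, hg⟩ : ∃ g : X ⟶ Y, r = p ≫ g := (Triangle.mk u p q).yoneda_exact₂ hΔ r hur
  refine ⟨g, fun f => ?_⟩
  obtain ⟨f', rfl⟩ := hp f
  rw [← hr, hg, Category.assoc]

lemma finrank_hom_le_of_distTriang (hfin : IsHomFinite k C) {Δ : Triangle C}
    (hΔ : Δ ∈ distTriang C) (P : C) :
    Module.finrank k (P ⟶ Δ.obj₂) ≤
      Module.finrank k (P ⟶ Δ.obj₁) + Module.finrank k (P ⟶ Δ.obj₃) := by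
  have := hfin P Δ.obj₁
  have := hfin P Δ.obj₂
  have := hfin P Δ.obj₃
  have h1 := (Linear.rightComp k P Δ.mor₂).finrank_range_add_finrank_ker
  have h2 : LinearMap.ker (Linear.rightComp k P Δ.mor₂) ≤
      LinearMap.range (Linear.rightComp k P Δ.mor₁) := by
    intro f hf
    obtain ⟨g, hg⟩ := Δ.coyoneda_exact₂ hΔ f hf
    exact ⟨g, hg.symm⟩
  have h3 := Submodule.finrank_mono h2
  have h4 := LinearMap.finrank_range_le (Linear.rightComp k P Δ.mor₁)
  have h5 := Submodule.finrank_le (LinearMap.range (Linear.rightComp k P Δ.mor₂))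
  omega

/-! ### The square of the suspension on objects, and invariance of the dimension function -/

variable [∀ n : ℤ, (shiftFunctor C n).Linear k]

/-- The suspension as a linear equivalence of Hom spaces. -/
noncomputable def shiftHomEquiv (k : Type w) [Field k] [Linear k C]
    [∀ n : ℤ, (shiftFunctor C n).Linear k] (X Y : C) (n : ℤ) :
    (X ⟶ Y) ≃ₗ[k] (X⟦n⟧ ⟶ Y⟦n⟧) :=
  LinearEquiv.ofBijective ((shiftFunctor C n).mapLinearMap k)
    ⟨(shiftFunctor C n).map_injective, (shiftFunctor C n).map_surjective⟩

/-- A symmetrizing form of `End T` yields an isomorphism `T ≅ T⟦2⟧` compatible with all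
endomorphisms of `T`. -/
lemma IsClusterTilting.exists_iso_shift_two (hfin : IsHomFinite k C) (hCY : IsTwoCalabiYau k C)
    {T : C} (hT : IsClusterTilting T) (hsymm : IsSymmetricAlgebra k (End T)) :
    ∃ s : T ≅ T⟦(2 : ℤ)⟧, ∀ f : T ⟶ T, f ≫ s.hom = s.hom ≫ f⟦(2 : ℤ)⟧' := by
  obtain ⟨φ, hφ⟩ := hCY
  obtain ⟨-, ψ, hψ⟩ := hsymm
  have := hfin T T
  have := hfin T (T⟦(2 : ℤ)⟧)
  have := hfin (T⟦(2 : ℤ)⟧) (T⟦(2 : ℤ)⟧)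
  let l : (T ⟶ T) →ₗ[k] k := ψ (1 : End T)
  have hl1 : ∀ f h : T ⟶ T, ψ f h = l (f ≫ h) := by
    intro f h
    have := hψ f 1 1 h
    rw [mul_one, mul_one, one_mul] at this
    exact this
  have hl2 : ∀ f h : T ⟶ T, ψ f h = l (h ≫ f) := by
    intro f h
    have := hψ 1 f 1 h
    rw [mul_one, one_mul, mul_one] at this
    exact this
  -- `s` is the Serre dual of the trace form `l`. Symmetry of `l` gives compatibility with
  -- endomorphisms, and nondegeneracy gives injectivity of f ↦ f ≫ s.
  obtain ⟨s, hs⟩ : ∃ s : T ⟶ T⟦(2 : ℤ)⟧, ∀ h, φ T T h s = l h :=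
    ⟨(Module.evalEquiv k (T ⟶ T⟦(2 : ℤ)⟧)).symm (l.comp (φ T T).symm.toLinearMap),
      fun h => by simp⟩
  have hpre : ∀ f h : T ⟶ T, φ T T h (f ≫ s) = l (h ≫ f) := by
    intro f h
    have := hφ (𝟙 T) h f s
    rw [CategoryTheory.Functor.map_id, Category.comp_id, Category.id_comp] at this
    rw [← this, hs]
  have hcomm : ∀ f : T ⟶ T, f ≫ s = s ≫ f⟦(2 : ℤ)⟧' := by
    intro f
    rw [← sub_eq_zero, ← Module.forall_dual_apply_eq_zero_iff k]
    intro F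
    obtain ⟨h, rfl⟩ := (φ T T).surjective F
    have := hφ f h (𝟙 T) s
    rw [Category.comp_id, Category.id_comp] at this
    rw [map_sub, hpre, ← this, hs, ← hl1, ← hl2, sub_self]
  have hinj : Function.Injective (Linear.rightComp k T s) := by
    rw [← LinearMap.ker_eq_bot, LinearMap.ker_eq_bot']
    intro f hf
    change f ≫ s = 0 at hf
    apply ψ.injective
    rw [map_zero]
    refine LinearMap.ext fun h => ?_
    rw [hl2, ← hpre, hf, map_zero, LinearMap.zero_apply]
  have hrank : Module.finrank k (T ⟶ T) = Module.finrank k (T ⟶ T⟦(2 : ℤ)⟧) := by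
    rw [(φ T T).finrank_eq, Subspace.dual_finrank_eq]
  have hsurj := (LinearMap.injective_iff_surjective_of_finrank_eq_finrank hrank).1 hinj
  -- The fibre `Z` lies in add T, where composition with `s` is injective; since u ≫ s = 0, `u`
  -- vanishes and `s` is a split monomorphism.
  obtain ⟨Z, u, q, hΔ⟩ := distinguished_cocone_triangle₁ s
  have hZ : InAdd T Z := hT.inAdd_fiber hΔ (inAdd_self T) hsurj
  have hus : u ≫ s = 0 := comp_distTriang_mor_zero₁₂ _ hΔ
  have hu : u = 0 := by
    obtain ⟨n, a, b, hab⟩ := (inAdd_iff _ _).1 hZ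
    rw [← Category.id_comp u, ← hab, Preadditive.sum_comp]
    refine Finset.sum_eq_zero fun j _ => ?_
    have : b j ≫ u = 0 := by
      apply hinj
      change (b j ≫ u) ≫ s = (0 : T ⟶ T) ≫ s
      rw [Category.assoc, hus, comp_zero, zero_comp]
    rw [Category.assoc, this, comp_zero]
  have hmono : Mono s := (Triangle.mk u s q).mono₂ hΔ hu
  have : IsSplitMono s := isSplitMono_of_mono s
  have hsr : s ≫ retraction s = 𝟙 T := IsSplitMono.id s
  -- End T and End (T⟦2⟧) have equal dimension, so the injective Φ hits the identity of T⟦2⟧, which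
  -- forces the retraction to be a two-sided inverse.
  let Φ : (T ⟶ T) →ₗ[k] (T⟦(2 : ℤ)⟧ ⟶ T⟦(2 : ℤ)⟧) :=
    (Linear.leftComp k _ (retraction s)).comp (Linear.rightComp k T s)
  have hΦ : ∀ f, Φ f = retraction s ≫ f ≫ s := fun f => rfl
  have hΦinj : Function.Injective Φ := by
    intro f g hfg
    rw [hΦ, hΦ] at hfg
    have := congrArg (fun h => s ≫ h ≫ retraction s) hfg
    simpa [hsr, reassoc_of% hsr] using this
  obtain ⟨f, hf⟩ := (LinearMap.injective_iff_surjective_of_finrank_eq_finrank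
    (shiftHomEquiv k T T 2).finrank_eq).1 hΦinj (𝟙 _)
  rw [hΦ] at hf
  have hrs : retraction s ≫ s = 𝟙 _ := by
    rw [← Category.comp_id (retraction s ≫ s), ← hf, Category.assoc, reassoc_of% hsr]
  exact ⟨⟨s, retraction s, hsr, hrs⟩, hcomm⟩

/-- An isomorphism `T ≅ T⟦2⟧` compatible with endomorphisms extends to `add T`. -/
lemma exists_iso_shift_two_of_inAdd {T : C} (s : T ≅ T⟦(2 : ℤ)⟧)
    (hs : ∀ f : T ⟶ T, f ≫ s.hom = s.hom ≫ f⟦(2 : ℤ)⟧') {M N : C} (hM : InAdd T M)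
    (hN : InAdd T N) (g : M ⟶ N) :
    ∃ (a : M ≅ M⟦(2 : ℤ)⟧) (b : N ≅ N⟦(2 : ℤ)⟧), g ≫ b.hom = a.hom ≫ g⟦(2 : ℤ)⟧' := by
  obtain ⟨m, a, b, hab⟩ := (inAdd_iff _ _).1 hM
  obtain ⟨n, c, d, hcd⟩ := (inAdd_iff _ _).1 hN
  -- The extension of `s` to M is ∑ a j ≫ s ≫ (b j)⟦2⟧. Its naturality reduces to `hs` for the
  -- endomorphisms b i ≫ g ≫ c j of T.
  have key : ∀ {M N : C} {m n : ℕ} (a : Fin m → (M ⟶ T)) (b : Fin m → (T ⟶ M))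
      (c : Fin n → (N ⟶ T)) (d : Fin n → (T ⟶ N)) (_ : ∑ j, a j ≫ b j = 𝟙 M)
      (_ : ∑ j, c j ≫ d j = 𝟙 N) (g : M ⟶ N),
      g ≫ ∑ j, c j ≫ s.hom ≫ (d j)⟦(2 : ℤ)⟧' =
        (∑ j, a j ≫ s.hom ≫ (b j)⟦(2 : ℤ)⟧') ≫ g⟦(2 : ℤ)⟧' := by
    intro M N m n a b c d hab hcd g
    have h1 : ∀ i, ∑ j, (b i ≫ g ≫ c j) ≫ s.hom ≫ (d j)⟦(2 : ℤ)⟧' =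
        s.hom ≫ (b i)⟦(2 : ℤ)⟧' ≫ g⟦(2 : ℤ)⟧' := by
      intro i
      have : ∀ j, (b i ≫ g ≫ c j) ≫ s.hom ≫ (d j)⟦(2 : ℤ)⟧' =
          s.hom ≫ (b i ≫ g ≫ c j ≫ d j)⟦(2 : ℤ)⟧' := by
        intro j
        rw [← Category.assoc, hs]
        simp
      simp only [this]
      rw [← Preadditive.comp_sum, ← Functor.map_sum, ← Preadditive.comp_sum,
        ← Preadditive.comp_sum, hcd]
      simp
    calc _ = (∑ i, a i ≫ b i) ≫ g ≫ ∑ j, c j ≫ s.hom ≫ (d j)⟦(2 : ℤ)⟧' := by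
          rw [hab, Category.id_comp]
      _ = ∑ i, a i ≫ ∑ j, (b i ≫ g ≫ c j) ≫ s.hom ≫ (d j)⟦(2 : ℤ)⟧' := by
          rw [Preadditive.sum_comp]
          refine Finset.sum_congr rfl fun i _ => ?_
          simp only [Preadditive.comp_sum, Category.assoc]
      _ = _ := by
          rw [Preadditive.sum_comp]
          simp only [h1]
          simp only [Category.assoc]
  have iso : ∀ {M : C} {m : ℕ} (a : Fin m → (M ⟶ T)) (b : Fin m → (T ⟶ M))
      (_ : ∑ j, a j ≫ b j = 𝟙 M), IsIso (∑ j, a j ≫ s.hom ≫ (b j)⟦(2 : ℤ)⟧') := by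
    intro M m a b hab
    have hs' : ∀ f : T ⟶ T, f⟦(2 : ℤ)⟧' ≫ s.inv = s.inv ≫ f := by
      intro f
      rw [← cancel_epi s.hom, ← Category.assoc, ← hs]
      simp
    have h2 : ∀ i, ∑ j, (b i ≫ a j) ≫ b j = b i := by
      intro i
      simp only [Category.assoc]
      rw [← Preadditive.comp_sum, hab, Category.comp_id]
    have h3 : ∀ i, ∑ j, (b i ≫ a j)⟦(2 : ℤ)⟧' ≫ (b j)⟦(2 : ℤ)⟧' = (b i)⟦(2 : ℤ)⟧' := by
      intro i
      simp only [← Functor.map_comp]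
      rw [← Functor.map_sum, h2]
    refine ⟨∑ j, (a j)⟦(2 : ℤ)⟧' ≫ s.inv ≫ b j, ?_, ?_⟩
    · have : ∀ i j, (a i ≫ s.hom ≫ (b i)⟦(2 : ℤ)⟧') ≫ (a j)⟦(2 : ℤ)⟧' ≫ s.inv ≫ b j =
          a i ≫ (b i ≫ a j) ≫ b j := by
        intro i j
        have := reassoc_of% (hs' (b i ≫ a j))
        simp only [Functor.map_comp, Category.assoc] at this
        simp [this]
      simp only [Preadditive.sum_comp]
      simp only [Preadditive.comp_sum, this]
      simp only [← Preadditive.comp_sum, h2, hab]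
    · have : ∀ i j, ((a i)⟦(2 : ℤ)⟧' ≫ s.inv ≫ b i) ≫ a j ≫ s.hom ≫ (b j)⟦(2 : ℤ)⟧' =
          (a i)⟦(2 : ℤ)⟧' ≫ (b i ≫ a j)⟦(2 : ℤ)⟧' ≫ (b j)⟦(2 : ℤ)⟧' := by
        intro i j
        have := reassoc_of% (hs (b i ≫ a j))
        simp [this]
      simp only [Preadditive.sum_comp]
      simp only [Preadditive.comp_sum, this]
      simp only [← Preadditive.comp_sum, h3]
      rw [← CategoryTheory.Functor.map_id, ← hab, Functor.map_sum]
      simp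
  have := iso a b hab
  have := iso c d hcd
  exact ⟨asIso (∑ j, a j ≫ s.hom ≫ (b j)⟦(2 : ℤ)⟧'), asIso (∑ j, c j ≫ s.hom ≫ (d j)⟦(2 : ℤ)⟧'),
    key a b c d hab hcd g⟩

/-- Under the hypotheses of the main theorem every object is isomorphic to its double
suspension. -/
lemma IsClusterTilting.nonempty_iso_shift_two (hfin : IsHomFinite k C)
    (hCY : IsTwoCalabiYau k C) {T : C} (hT : IsClusterTilting T)
    (hsymm : IsSymmetricAlgebra k (End T)) (X : C) : Nonempty (X ≅ X⟦(2 : ℤ)⟧) := by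
  obtain ⟨s, hs⟩ := hT.exists_iso_shift_two hfin hCY hsymm
  obtain ⟨T₁, T₀, u, p, q, hΔ, h₁, h₀, -⟩ := hT.exists_presentation hfin X
  obtain ⟨a, b, hab⟩ := exists_iso_shift_two_of_inAdd s hs h₁ h₀ u
  have hΔ' := Triangle.shift_distinguished _ hΔ 2
  -- Isomorphic maps have isomorphic cones. Shifting a triangle by 2 introduces the sign (-1)² = 1.
  obtain ⟨e, -⟩ := exists_iso_of_arrow_iso _ _ hΔ hΔ' (Arrow.isoMk a b (by
    have h2 : ((shiftFunctor (Triangle C) (2 : ℤ)).obj (Triangle.mk u p q)).mor₁ =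
        u⟦(2 : ℤ)⟧' := by
      change (2 : ℤ).negOnePow • u⟦(2 : ℤ)⟧' = _
      rw [Int.negOnePow_even 2 (by decide), one_smul]
    exact (congrArg (a.hom ≫ ·) h2).trans hab.symm))
  exact ⟨Triangle.π₃.mapIso e⟩

/-- Suspend once and use X⟦2⟧ ≅ X. -/
lemma IsClusterTilting.finrank_hom_shift (hfin : IsHomFinite k C) (hCY : IsTwoCalabiYau k C)
    {T : C} (hT : IsClusterTilting T) (hsymm : IsSymmetricAlgebra k (End T)) (X : C) :
    Module.finrank k (T ⟶ X⟦(1 : ℤ)⟧) = Module.finrank k (T⟦(1 : ℤ)⟧ ⟶ X) := by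
  obtain ⟨e⟩ := hT.nonempty_iso_shift_two hfin hCY hsymm X
  let α : X⟦(1 : ℤ)⟧⟦(1 : ℤ)⟧ ≅ X :=
    ((shiftFunctorAdd' C (1 : ℤ) 1 2 (by norm_num)).app X).symm ≪≫ e.symm
  exact ((shiftHomEquiv k T (X⟦(1 : ℤ)⟧) 1).trans
    (Linear.homCongr k (Iso.refl _) α)).finrank_eq

lemma IsClusterTilting.totalDim_shift (hfin : IsHomFinite k C) (hCY : IsTwoCalabiYau k C)
    {T : C} (hT : IsClusterTilting T) (hsymm : IsSymmetricAlgebra k (End T)) (X : C) :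
    totalDim k T (X⟦(1 : ℤ)⟧) = totalDim k T X := by
  rw [totalDim, totalDim, hT.finrank_hom_shift hfin hCY hsymm,
    ← (shiftHomEquiv k T X 1).finrank_eq, add_comm]

/-- If both summands vanish, then Hom(T, X⟦1⟧) = 0 puts `X` in add T, and Hom(T, X) = 0 then kills
its identity. -/
lemma IsClusterTilting.totalDim_pos (hfin : IsHomFinite k C) (hCY : IsTwoCalabiYau k C)
    {T : C} (hT : IsClusterTilting T) (hsymm : IsSymmetricAlgebra k (End T)) {X : C}
    (hX : Indecomposable X) : 0 < totalDim k T X := by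
  rw [Nat.pos_iff_ne_zero]
  intro h0
  have := hfin T X
  have := hfin T (X⟦(1 : ℤ)⟧)
  obtain ⟨h1, h2⟩ := Nat.add_eq_zero_iff.1 h0
  rw [← hT.finrank_hom_shift hfin hCY hsymm] at h2
  have s1 := Module.finrank_zero_iff.1 h1
  have s2 := Module.finrank_zero_iff.1 h2
  obtain ⟨n, a, b, hab⟩ := (inAdd_iff T X).1 ((hT.1 X).2 fun f => Subsingleton.elim _ _)
  apply hX.id_ne_zero
  rw [← hab]
  exact Finset.sum_eq_zero fun j _ => by rw [Subsingleton.elim (b j) 0, comp_zero]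

end

end

/-! ### The Harada–Sai lemma for `Hom(T, -)` -/

section

/-- The first rank equality makes `B` injective on the range of `A`; the second makes the dimensions
add up. -/
lemma isCompl_range_ker_of_finrank_eq {k U V W : Type*} [Field k] [AddCommGroup U] [Module k U]
    [AddCommGroup V] [Module k V] [AddCommGroup W] [Module k W] [Module.Finite k U]
    [Module.Finite k V] (A : U →ₗ[k] V) (B : V →ₗ[k] W)
    (hA : Module.finrank k (LinearMap.range (B.comp A)) = Module.finrank k (LinearMap.range A))
    (hB : Module.finrank k (LinearMap.range (B.comp A)) = Module.finrank k (LinearMap.range B)) :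
    IsCompl (LinearMap.range A) (LinearMap.ker B) := by
  have h1 := (B.comp A).finrank_range_add_finrank_ker
  have h2 := A.finrank_range_add_finrank_ker
  have h3 := B.finrank_range_add_finrank_ker
  have hker : LinearMap.ker A = LinearMap.ker (B.comp A) :=
    Submodule.eq_of_le_of_finrank_eq (LinearMap.ker_le_ker_comp A B) (by omega)
  have hdisj : Disjoint (LinearMap.range A) (LinearMap.ker B) := by
    rw [Submodule.disjoint_def]
    rintro _ ⟨u, rfl⟩ hu
    have : u ∈ LinearMap.ker (B.comp A) := hu
    rwa [← hker] at this
  refine ⟨hdisj, ?_⟩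
  rw [codisjoint_iff]
  apply Submodule.eq_top_of_finrank_eq
  have h4 := Submodule.finrank_sup_add_finrank_inf_eq (LinearMap.range A) (LinearMap.ker B)
  rw [hdisj.eq_bot, finrank_bot] at h4
  omega

section

variable {k : Type w} [Field k] {C : Type u} [Category.{v} C] [Preadditive C] [Linear k C]

/-- A composite of `n` radical maps between objects satisfying `P`, preceded by an arbitrary map
between such objects. -/
def IsRadicalChain (P : C → Prop) : ℕ → ∀ {X Y : C}, (X ⟶ Y) → Prop
  | 0, X, Y, _ => P X ∧ P Y
  | n + 1, X, Y, f => P Y ∧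
      ∃ (Z : C) (u : X ⟶ Z) (r : Z ⟶ Y), IsRadicalChain P n u ∧ IsRadical r ∧ f = u ≫ r

lemma IsRadicalChain.right {P : C → Prop} {n : ℕ} {X Y : C} {f : X ⟶ Y}
    (h : IsRadicalChain P n f) : P Y := by
  cases n with
  | zero => exact h.2
  | succ n => exact h.1

lemma IsRadicalChain.left {P : C → Prop} {n : ℕ} {X Y : C} {f : X ⟶ Y}
    (h : IsRadicalChain P n f) : P X := by
  induction n generalizing Y with
  | zero => exact h.1
  | succ n ih =>
    obtain ⟨-, _, _, _, hu, -⟩ := h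
    exact ih hu

/-- Isolating one radical map in the middle matches the recursion 2^(m+1) - 1 = (2^m - 1) + 1 + (2^m
- 1) of the Harada–Sai bound. -/
lemma IsRadicalChain.split {P : C → Prop} {n m : ℕ} {X Y : C} {f : X ⟶ Y}
    (h : IsRadicalChain P (n + 1 + m) f) :
    ∃ (Z Z' : C) (u : X ⟶ Z) (r : Z ⟶ Z') (t : Z' ⟶ Y), IsRadicalChain P n u ∧ IsRadical r ∧
      IsRadicalChain P m t ∧ f = u ≫ r ≫ t := by
  induction m generalizing Y with
  | zero =>
    obtain ⟨hY, Z, u, r, hu, hr, rfl⟩ := h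
    exact ⟨Z, Y, u, r, 𝟙 Y, hu, hr, ⟨hY, hY⟩, by simp⟩
  | succ m ih =>
    obtain ⟨hY, W, u', r', hu', hr', rfl⟩ := h
    obtain ⟨Z, Z', u, r, t, hu, hr, ht, rfl⟩ := ih hu'
    exact ⟨Z, Z', u, r, t ≫ r', hu, hr, ⟨hY, W, t, r', ht, hr', rfl⟩, by simp⟩

end

variable {k : Type w} [Field k] {C : Type u} [Category.{v} C] [Preadditive C] [Linear k C]
  [HasZeroObject C] [HasShift C ℤ] [∀ n : ℤ, (shiftFunctor C n).Additive] [Pretriangulated C]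
  [IsIdempotentComplete C]

/-- If the ranks of `Hom(T, u)`, `Hom(T, t)` and `Hom(T, u ≫ t)` agree and the middle object is
indecomposable, then `Hom(T, u)` is surjective and `Hom(T, t)` is injective. -/
lemma IsClusterTilting.surjective_injective_of_finrank_eq (hfin : IsHomFinite k C) {T : C}
    (hT : IsClusterTilting T) {X Y Z : C} (hZ : Indecomposable Z) (u : X ⟶ Z) (t : Z ⟶ Y)
    (hpos : 0 < Module.finrank k (LinearMap.range (Linear.rightComp k T (u ≫ t))))
    (hu : Module.finrank k (LinearMap.range (Linear.rightComp k T (u ≫ t))) =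
      Module.finrank k (LinearMap.range (Linear.rightComp k T u)))
    (ht : Module.finrank k (LinearMap.range (Linear.rightComp k T (u ≫ t))) =
      Module.finrank k (LinearMap.range (Linear.rightComp k T t))) :
    Function.Surjective (Linear.rightComp k T u) ∧
      Function.Injective (Linear.rightComp k T t) := by
  have := hfin T X
  have := hfin T Z
  have := hfin Z Z
  set A := Linear.rightComp k T u
  set B := Linear.rightComp k T t
  have hAB : Linear.rightComp k T (u ≫ t) = B.comp A := by
    ext f
    exact (Category.assoc _ _ _).symm
  rw [hAB] at hpos hu ht
  have hc := isCompl_range_ker_of_finrank_eq A B hu ht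
  have hA : ∀ (a : T ⟶ T) (f : T ⟶ Z), f ∈ LinearMap.range A → a ≫ f ∈ LinearMap.range A := by
    rintro a _ ⟨g, rfl⟩
    exact ⟨a ≫ g, Category.assoc _ _ _⟩
  have hB : ∀ (a : T ⟶ T) (f : T ⟶ Z), f ∈ LinearMap.ker B → a ≫ f ∈ LinearMap.ker B := by
    intro a f hf
    have hf' : f ≫ t = 0 := hf
    change (a ≫ f) ≫ t = 0
    rw [Category.assoc, hf', comp_zero]
  -- The projection onto range A along ker B is equivariant, hence induced by an endomorphism of Z.
  -- By locality it is bijective, unless range A = 0, which the positive rank excludes.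
  obtain ⟨π, hπ1, hπ2⟩ : ∃ π : (T ⟶ Z) →ₗ[k] (T ⟶ Z),
      (∀ f ∈ LinearMap.range A, π f = f) ∧ ∀ f ∈ LinearMap.ker B, π f = 0 :=
    ⟨(LinearMap.range A).subtype.comp (Submodule.projectionOnto _ _ hc),
      fun f hf => congrArg Subtype.val (Submodule.projectionOnto_apply_left hc ⟨f, hf⟩),
      fun f hf => congrArg Subtype.val
        (Submodule.projectionOnto_apply_right hc ⟨f, hf⟩)⟩
  have hdec : ∀ f : T ⟶ Z, ∃ g ∈ LinearMap.range A, ∃ h ∈ LinearMap.ker B, g + h = f := by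
    intro f
    have : f ∈ LinearMap.range A ⊔ LinearMap.ker B := by
      rw [hc.sup_eq_top]; trivial
    exact Submodule.mem_sup.1 this
  obtain ⟨ε, hε⟩ := hT.exists_hom_of_equivariant hfin π (by
    intro a f
    obtain ⟨g, hg, h, hh, rfl⟩ := hdec f
    rw [Preadditive.comp_add, map_add, map_add, hπ1 g hg, hπ2 h hh, hπ1 _ (hA a g hg),
      hπ2 _ (hB a h hh), add_zero, add_zero])
  rcases hZ.isIso_or_isIso_sub (k := k) ε with hi | hi
  · constructor
    · intro f
      obtain ⟨g, ⟨g', hg'⟩, h, hh, hgh⟩ := hdec (f ≫ inv ε)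
      refine ⟨g', ?_⟩
      have h1 := hε (f ≫ inv ε)
      rw [← hgh, map_add, hπ1 g ⟨g', hg'⟩, hπ2 h hh, add_zero, hgh] at h1
      rw [hg', h1]
      simp
    · rw [← LinearMap.ker_eq_bot, LinearMap.ker_eq_bot']
      intro f hf
      have h1 := hε f
      rw [hπ2 f hf] at h1
      rw [← cancel_mono ε, ← h1, zero_comp]
  · exfalso
    have hA0 : LinearMap.range A = ⊥ := by
      rw [eq_bot_iff]
      intro f hf
      have h1 := hε f
      rw [hπ1 f hf] at h1
      rw [Submodule.mem_bot, ← cancel_mono (𝟙 Z - ε), Preadditive.comp_sub, ← h1]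
      simp
    rw [hu, hA0, finrank_bot] at hpos
    exact lt_irrefl _ hpos

/-- The Harada–Sai lemma. -/
lemma IsClusterTilting.finrank_range_le_of_isRadicalChain (hfin : IsHomFinite k C) {T : C}
    (hT : IsClusterTilting T) (b m : ℕ) {X Y : C} (f : X ⟶ Y)
    (hf : IsRadicalChain (fun Z => Indecomposable Z ∧ Module.finrank k (T ⟶ Z) ≤ b)
      (2 ^ m - 1) f) :
    Module.finrank k (LinearMap.range (Linear.rightComp k T f)) ≤ b - m := by
  induction m generalizing X Y with
  | zero =>
    have := hfin T Y
    exact (Submodule.finrank_le _).trans hf.right.2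
  | succ m ih =>
    have hpow : 2 ^ (m + 1) - 1 = (2 ^ m - 1) + 1 + (2 ^ m - 1) := by
      have := Nat.one_le_two_pow (n := m)
      rw [pow_succ]; omega
    rw [hpow] at hf
    obtain ⟨Z, Z', u, r, t, hu, hr, ht, rfl⟩ := hf.split
    have hZ := hu.right
    have hZ' := ht.left
    have := hfin T X
    have := hfin T Y
    have := hfin T Z
    have := hfin T Z'
    have := hfin Z Z
    have hcomp : ∀ {X Y Z : C} (f : X ⟶ Y) (g : Y ⟶ Z), Linear.rightComp k T (f ≫ g) =
        (Linear.rightComp k T g).comp (Linear.rightComp k T f) := by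
      intro X Y Z f g
      ext h
      exact (Category.assoc _ _ _).symm
    have hle1 : ∀ {X Y Z : C} (f : X ⟶ Y) (g : Y ⟶ Z),
        Module.finrank k (LinearMap.range (Linear.rightComp k T (f ≫ g))) ≤
        Module.finrank k (LinearMap.range (Linear.rightComp k T g)) := by
      intro X Y Z f g
      have := hfin T Z
      rw [hcomp]
      exact Submodule.finrank_mono (LinearMap.range_comp_le_range _ _)
    have hle2 : ∀ {X Y Z : C} (f : X ⟶ Y) (g : Y ⟶ Z),
        Module.finrank k (LinearMap.range (Linear.rightComp k T (f ≫ g))) ≤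
        Module.finrank k (LinearMap.range (Linear.rightComp k T f)) := by
      intro X Y Z f g
      have := hfin T Y
      rw [hcomp, LinearMap.range_comp]
      exact Submodule.finrank_map_le _ _
    -- If the rank does not drop, the ranks of u, u ≫ r, r ≫ t and t all equal b - m > 0. Then `r`
    -- is bijective on Hom(T, -) with an inverse induced by some g, so 𝟙 - r ≫ g is zero on Hom(T,
    -- Z); it is also invertible because `r` is radical, whence Hom(T, Z) = 0.
    by_contra! hcon
    have hu' := ih u hu
    have ht' := ih t ht
    have e1 := hle2 u (r ≫ t)
    have e2 := hle1 u (r ≫ t)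
    have e3 := hle1 r t
    have e4 : Module.finrank k (LinearMap.range (Linear.rightComp k T (u ≫ r ≫ t))) ≤
        Module.finrank k (LinearMap.range (Linear.rightComp k T (u ≫ r))) := by
      rw [← Category.assoc]; exact hle2 (u ≫ r) t
    have e5 := hle2 u r
    obtain ⟨-, hinj⟩ := hT.surjective_injective_of_finrank_eq hfin hZ.1 u (r ≫ t)
      (by omega) (by omega) (by omega)
    obtain ⟨hsurj, -⟩ := hT.surjective_injective_of_finrank_eq hfin hZ'.1 (u ≫ r) t
      (by rw [Category.assoc]; omega) (by rw [Category.assoc]; omega)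
      (by rw [Category.assoc]; omega)
    have hbij : Function.Bijective (Linear.rightComp k T r) := by
      rw [hcomp, LinearMap.coe_comp] at hinj hsurj
      exact ⟨hinj.of_comp, hsurj.of_comp⟩
    let e := LinearEquiv.ofBijective _ hbij
    have he : ∀ f : T ⟶ Z', e.symm f ≫ r = f := fun f => e.apply_symm_apply f
    have he' : ∀ f : T ⟶ Z, e.symm (f ≫ r) = f := fun f => e.symm_apply_apply f
    obtain ⟨g, hg⟩ := hT.exists_hom_of_equivariant hfin e.symm.toLinearMap (by
      intro a f
      change e.symm (a ≫ f) = a ≫ e.symm f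
      nth_rewrite 1 [← he f]
      rw [← Category.assoc, he'])
    have hg' : ∀ f : T ⟶ Z, f ≫ r ≫ g = f := by
      intro f
      rw [← Category.assoc, ← hg]
      exact he' f
    have hi := hr g
    have h0 : ∀ f : T ⟶ Z, f = 0 := by
      intro f
      rw [← cancel_mono (𝟙 Z - r ≫ g), Preadditive.comp_sub, hg']
      simp
    have : Subsingleton (T ⟶ Z) := ⟨fun f g => by rw [h0 f, h0 g]⟩
    have h1 := Module.finrank_zero_of_subsingleton (R := k) (M := T ⟶ Z)
    have h2 := Submodule.finrank_le (LinearMap.range (Linear.rightComp k T u))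
    omega

end

/-! ### Stable translation quivers with an unbounded subadditive function -/

section

section Combinatorics

/-- The combinatorial data of a translation quiver with `τ² = 1` and a positive `τ`-invariant
subadditive function: `a x y` is the number of arrows from `x` to `y`. -/
structure SubadditiveQuiver (V : Type u) where
  /-- the number of arrows -/
  a : V → V → ℕ
  /-- the translation -/
  τ : V → V
  /-- the subadditive function -/
  d : V → ℕ
  τ_τ : ∀ x, τ (τ x) = x
  a_eq : ∀ x y, a x y = a (τ y) x
  d_pos : ∀ x, 0 < d x
  d_τ : ∀ x, d (τ x) = d x
  sum_le : ∀ (x : V) (S : Finset V), ∑ y ∈ S, a y x * d y ≤ 2 * d x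

namespace SubadditiveQuiver

variable {V : Type u} (Q : SubadditiveQuiver V)

lemma a_τ_τ (x y : V) : Q.a (Q.τ x) (Q.τ y) = Q.a x y := by
  rw [Q.a_eq x y, Q.a_eq (Q.τ y) x]

lemma a_τ_right (x y : V) : Q.a x (Q.τ y) = Q.a y x := by
  rw [Q.a_eq, Q.τ_τ]

lemma a_mul_d_le (x y : V) : Q.a y x * Q.d y ≤ 2 * Q.d x := by
  simpa using Q.sum_le x {y}

lemma a_mul_d_le' (x y : V) : Q.a x y * Q.d y ≤ 2 * Q.d x := by
  have := Q.a_mul_d_le x (Q.τ y)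
  rwa [Q.d_τ, ← Q.a_eq] at this

/-- A vertex of which some predecessor has a larger value. -/
def HasUp (y : V) : Prop := ∃ u, Q.a u y ≠ 0 ∧ Q.d y < Q.d u

/-- If `y` has an arrow from a vertex `u` of larger value, then at most one more arrow ends in `y`,
and it comes from a vertex of smaller value. -/
lemma up_unique {y u z : V} (hu : Q.a u y ≠ 0) (hud : Q.d y < Q.d u) (hz : Q.a z y ≠ 0) :
    Q.a z y = 1 ∧ (z = u ∨ Q.d z < Q.d y) := by
  classical
  have h1 := Q.a_mul_d_le y u
  -- Every predecessor has at least half the value of y, while a predecessor u larger than y leaves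
  -- less than d y for all others.
  have hzy : Q.d y ≤ 2 * Q.d z := by
    have := Q.a_mul_d_le' z y
    nlinarith [Nat.pos_of_ne_zero hz]
  by_cases hzu : z = u
  · subst hzu
    refine ⟨?_, Or.inl rfl⟩
    have : Q.a z y < 2 := by
      by_contra! h
      nlinarith
    omega
  · have h2 := Q.sum_le y {z, u}
    rw [Finset.sum_pair hzu] at h2
    have hz1 := Nat.pos_of_ne_zero hz
    have hu1 := Nat.pos_of_ne_zero hu
    have hu2 : Q.d u ≤ Q.a u y * Q.d u := Nat.le_mul_of_pos_left _ hu1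
    have hz2 : Q.d z ≤ Q.a z y * Q.d z := Nat.le_mul_of_pos_left _ hz1
    refine ⟨?_, Or.inr (by omega)⟩
    have : Q.a z y < 2 := by
      by_contra! h
      have : 2 * Q.d z ≤ Q.a z y * Q.d z := Nat.mul_le_mul_right _ h
      omega
    omega

/-- Two distinct small predecessors contribute at least d y together, and `u` contributes more than
d y, exceeding the bound 2 d y. -/
lemma down_unique {y u z z' : V} (hu : Q.a u y ≠ 0) (hud : Q.d y < Q.d u) (hz : Q.a z y ≠ 0)
    (hz' : Q.a z' y ≠ 0) (hzd : Q.d z < Q.d y) (hzd' : Q.d z' < Q.d y) : z = z' := by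
  classical
  by_contra hne
  have hdy : ∀ z, Q.a z y ≠ 0 → Q.d y ≤ 2 * Q.d z ∧ Q.d z ≤ Q.a z y * Q.d z := by
    intro z hz
    have := Q.a_mul_d_le' z y
    have h1 := Nat.pos_of_ne_zero hz
    exact ⟨by nlinarith, Nat.le_mul_of_pos_left _ h1⟩
  have h1 : u ∉ ({z, z'} : Finset V) := by
    rw [Finset.mem_insert, Finset.mem_singleton]
    rintro (rfl | rfl) <;> omega
  have h2 := Q.sum_le y (insert u {z, z'})
  rw [Finset.sum_insert h1, Finset.sum_pair hne] at h2
  have := hdy u hu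
  have := hdy z hz
  have := hdy z' hz'
  omega

/-- The connected component of a vertex. -/
def comp (x : V) : Set V := {y | Relation.EqvGen (fun a b => Q.a a b ≠ 0) x y}

variable {Q} {x₀ : V}

lemma mem_comp_of_arrow {y z : V} (hy : y ∈ Q.comp x₀) (h : Q.a y z ≠ 0) : z ∈ Q.comp x₀ :=
  Relation.EqvGen.trans _ _ _ hy (Relation.EqvGen.rel _ _ h)

lemma mem_comp_of_arrow' {y z : V} (hy : y ∈ Q.comp x₀) (h : Q.a z y ≠ 0) : z ∈ Q.comp x₀ :=
  Relation.EqvGen.trans _ _ _ hy (Relation.EqvGen.symm _ _ (Relation.EqvGen.rel _ _ h))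

/-- A set closed under arrows in both directions that meets a component contains it. -/
lemma comp_subset {S : Set V} (hS : ∀ y z, Q.a y z ≠ 0 → (y ∈ S ↔ z ∈ S)) {y : V}
    (hy : y ∈ Q.comp x₀) (hyS : y ∈ S) : Q.comp x₀ ⊆ S := by
  have key : ∀ y z, Relation.EqvGen (fun a b => Q.a a b ≠ 0) y z → (y ∈ S ↔ z ∈ S) := by
    intro y z h
    induction h with
    | rel y z h => exact hS y z h
    | refl y => exact Iff.rfl
    | symm y z _ ih => exact ih.symm
    | trans y z w _ _ ih1 ih2 => exact ih1.trans ih2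
  intro z hz
  exact (key y z (Relation.EqvGen.trans _ _ _ (Relation.EqvGen.symm _ _ hy) hz)).1 hyS

lemma exists_arrow_of_infinite (hinf : (Q.comp x₀).Infinite) {y : V} (hy : y ∈ Q.comp x₀) :
    ∃ z, Q.a y z ≠ 0 ∨ Q.a z y ≠ 0 := by
  by_contra! hcon
  refine hinf ((Set.finite_singleton y).subset (comp_subset (fun u z h => ?_) hy rfl))
  simp only [Set.mem_singleton_iff]
  constructor
  · rintro rfl
    exact (h (hcon z).1).elim
  · rintro rfl
    exact (h (hcon u).2).elim

/-- An arrow at y gives a path of length two between y and τy. Infiniteness serves to exclude an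
isolated vertex. -/
lemma τ_mem_comp (hinf : (Q.comp x₀).Infinite) {y : V} (hy : y ∈ Q.comp x₀) :
    Q.τ y ∈ Q.comp x₀ := by
  obtain ⟨z, h | h⟩ := exists_arrow_of_infinite hinf hy
  · refine mem_comp_of_arrow (mem_comp_of_arrow hy h) (z := Q.τ y) ?_
    rwa [Q.a_τ_right]
  · refine mem_comp_of_arrow' (mem_comp_of_arrow' hy h) (z := Q.τ y) ?_
    rwa [← Q.a_eq]

/-- If the function is unbounded on a component, every vertex has an arrow from a vertex of
larger value. -/
lemma hasUp_of_unbounded (hunb : ∀ b, ∃ y ∈ Q.comp x₀, b < Q.d y) {y : V}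
    (hy : y ∈ Q.comp x₀) : Q.HasUp y := by
  by_contra hup
  let r : V → V → Prop := fun p q => Q.a p q ≠ 0 ∧ Q.d q ≤ Q.d p
  -- If nothing larger maps to y, the vertices below y and τy along non-increasing paths are closed
  -- under all arrows, so they contain the component and bound d by d y.
  let G : Set V := {p | Relation.ReflTransGen r y p ∨ Relation.ReflTransGen r (Q.τ y) p}
  have hr : ∀ p q, r p q → r (Q.τ p) (Q.τ q) := by
    rintro p q ⟨h1, h2⟩
    exact ⟨by rwa [Q.a_τ_τ], by rwa [Q.d_τ, Q.d_τ]⟩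
  have hGτ : ∀ p ∈ G, Q.τ p ∈ G := by
    rintro p (hp | hp)
    · exact Or.inr (Relation.ReflTransGen.lift Q.τ (p := r) hr _ _ hp)
    · left
      have : Relation.ReflTransGen r (Q.τ (Q.τ y)) (Q.τ p) :=
        Relation.ReflTransGen.lift Q.τ (p := r) hr _ _ hp
      rwa [Q.τ_τ] at this
  have hupτ : ¬ Q.HasUp (Q.τ y) := by
    rintro ⟨u, h1, h2⟩
    refine hup ⟨Q.τ u, ?_, ?_⟩
    · rwa [← Q.a_τ_τ, Q.τ_τ]
    · rwa [Q.d_τ, ← Q.d_τ y]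
  have hstep : ∀ p ∈ G, ∀ q, r p q → q ∈ G := by
    rintro p (hp | hp) q hq
    exacts [Or.inl (hp.tail hq), Or.inr (hp.tail hq)]
  have hpred : ∀ p ∈ G, ¬ Q.HasUp p ∨ ∃ p' ∈ G, r p' p := by
    rintro p (hp | hp)
    · rcases Relation.ReflTransGen.cases_tail hp with rfl | ⟨p', h1, h2⟩
      exacts [Or.inl hup, Or.inr ⟨p', Or.inl h1, h2⟩]
    · rcases Relation.ReflTransGen.cases_tail hp with rfl | ⟨p', h1, h2⟩
      exacts [Or.inl hupτ, Or.inr ⟨p', Or.inr h1, h2⟩]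
  have hin : ∀ p ∈ G, ∀ q, Q.a q p ≠ 0 → q ∈ G := by
    intro p hp q hq
    by_cases hd : Q.d q ≤ Q.d p
    · have : Q.τ q ∈ G := hstep p hp _ ⟨by rwa [Q.a_τ_right], by rwa [Q.d_τ]⟩
      simpa [Q.τ_τ] using hGτ _ this
    · push Not at hd
      rcases hpred p hp with h | ⟨p', hp', h1, h2⟩
      · exact (h ⟨q, hq, hd⟩).elim
      · rcases (Q.up_unique hq hd h1).2 with rfl | h
        · exact hp'
        · omega
  have hout : ∀ p ∈ G, ∀ q, Q.a p q ≠ 0 → q ∈ G := by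
    intro p hp q hq
    have : Q.τ q ∈ G := hin p hp _ (by rwa [← Q.a_eq])
    simpa [Q.τ_τ] using hGτ _ this
  have hsub : Q.comp x₀ ⊆ G :=
    comp_subset (fun p q h => ⟨fun hp => hout p hp q h, fun hq => hin q hq p h⟩) hy
      (Or.inl Relation.ReflTransGen.refl)
  have hmono : ∀ p q, Relation.ReflTransGen r p q → Q.d q ≤ Q.d p := by
    intro p q h
    induction h with
    | refl => exact le_rfl
    | tail _ h ih => exact h.2.trans ih
  obtain ⟨z, hz, hzd⟩ := hunb (Q.d y)
  rcases hsub hz with h | h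
  · have := hmono _ _ h
    omega
  · have := hmono _ _ h
    rw [Q.d_τ] at this
    omega

/-- A component on which the function is unbounded is a ray of `τ`-orbits. -/
lemma exists_ray (hunb : ∀ b, ∃ y ∈ Q.comp x₀, b < Q.d y) :
    ∃ y : ℕ → V, (∀ n, y n ∈ Q.comp x₀) ∧ StrictMono (fun n => Q.d (y n)) ∧
      (∀ n, Q.a (y n) (y (n + 1)) = 1) ∧
      (∀ n z, Q.a z (y n) ≠ 0 → z = Q.τ (y (n + 1)) ∨ ∃ m, n = m + 1 ∧ z = y m) ∧
      (∀ z ∈ Q.comp x₀, ∃ n, z = y n ∨ z = Q.τ (y n)) := by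
  classical
  have hup : ∀ y : Q.comp x₀, ∃ z : Q.comp x₀, Q.a y.1 z.1 = 1 ∧ Q.d y.1 < Q.d z.1 := by
    rintro ⟨y, hy⟩
    obtain ⟨u, hu, hud⟩ := hasUp_of_unbounded hunb hy
    have h1 : Q.a y (Q.τ u) ≠ 0 := by rwa [Q.a_τ_right]
    refine ⟨⟨Q.τ u, mem_comp_of_arrow hy h1⟩, ?_, ?_⟩
    · rw [Q.a_τ_right]
      exact (Q.up_unique hu hud hu).1
    · rwa [Q.d_τ]
  choose s hs1 hs2 using hup
  obtain ⟨y₀, hy₀, hmin⟩ : ∃ y₀ ∈ Q.comp x₀, ∀ z ∈ Q.comp x₀, Q.d y₀ ≤ Q.d z := by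
    have hne : (Q.comp x₀).Nonempty := ⟨x₀, Relation.EqvGen.refl x₀⟩
    obtain ⟨y₀, h1, h2⟩ := exists_minimalFor_of_wellFoundedLT (· ∈ Q.comp x₀) Q.d hne
    exact ⟨y₀, h1, fun z hz => (le_total (Q.d y₀) (Q.d z)).elim id fun h => h2 hz h⟩
  let Y : ℕ → Q.comp x₀ := fun n => s^[n] ⟨y₀, hy₀⟩
  have hY : ∀ n, Y (n + 1) = s (Y n) := fun n => Function.iterate_succ_apply' s n _
  have ha : ∀ n, Q.a (Y n).1 (Y (n + 1)).1 = 1 := fun n => by rw [hY]; exact hs1 _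
  have hd : ∀ n, Q.d (Y n).1 < Q.d (Y (n + 1)).1 := fun n => by rw [hY]; exact hs2 _
  have hpred : ∀ n z, Q.a z (Y n).1 ≠ 0 →
      z = Q.τ (Y (n + 1)).1 ∨ ∃ m, n = m + 1 ∧ z = (Y m).1 := by
    intro n z hz
    have hu : Q.a (Q.τ (Y (n + 1)).1) (Y n).1 ≠ 0 := by
      rw [← Q.a_eq, ha]; exact one_ne_zero
    have hud : Q.d (Y n).1 < Q.d (Q.τ (Y (n + 1)).1) := by rw [Q.d_τ]; exact hd n
    rcases (Q.up_unique hu hud hz).2 with h | h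
    · exact Or.inl h
    · right
      cases n with
      | zero =>
        exact absurd h (not_lt.2 (hmin z (mem_comp_of_arrow' hy₀ hz)))
      | succ m =>
        exact ⟨m, rfl, Q.down_unique hu hud hz (by rw [ha]; exact one_ne_zero) h (hd m)⟩
  refine ⟨fun n => (Y n).1, fun n => (Y n).2, strictMono_nat_of_lt_succ hd, ha, hpred, ?_⟩
  let S : Set V := {z | ∃ n, z = (Y n).1 ∨ z = Q.τ (Y n).1}
  have hSτ : ∀ z ∈ S, Q.τ z ∈ S := by
    rintro z ⟨n, rfl | rfl⟩
    exacts [⟨n, Or.inr rfl⟩, ⟨n, Or.inl (Q.τ_τ _)⟩]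
  have hSτ' : ∀ z, Q.τ z ∈ S → z ∈ S := fun z hz => by simpa [Q.τ_τ] using hSτ _ hz
  have hin' : ∀ n z, Q.a z (Y n).1 ≠ 0 → z ∈ S := by
    intro n z hz
    rcases hpred n z hz with h | ⟨m, -, h⟩
    exacts [⟨n + 1, Or.inr h⟩, ⟨m, Or.inl h⟩]
  have hin : ∀ p ∈ S, ∀ z, Q.a z p ≠ 0 → z ∈ S := by
    rintro p ⟨n, rfl | rfl⟩ z hz
    · exact hin' n z hz
    · exact hSτ' z (hin' n _ (by rwa [← Q.a_τ_τ, Q.τ_τ]))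
  have hsub : Q.comp x₀ ⊆ S :=
    comp_subset (fun p q h => ⟨fun hp => hSτ' q (hin p hp _ (by rwa [← Q.a_eq])),
      fun hq => hin q hq p h⟩) hy₀ ⟨0, Or.inl rfl⟩
  exact fun z hz => hsub hz

/-- A component on which the function is unbounded is a stable tube of rank one or two. -/
theorem exists_tube (hinf : (Q.comp x₀).Infinite)
    (hunb : ∀ b, ∃ y ∈ Q.comp x₀, b < Q.d y) :
    ∃ r, (r = 1 ∨ r = 2) ∧ ∃ e : ℕ × ZMod r ≃ Q.comp x₀,
      (∀ p q, Q.a (e p).1 (e q).1 = tubeArrows r p q) ∧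
      (∀ q : ℕ × ZMod r, Q.τ (e q).1 = (e (q.1, q.2 - 1)).1) := by
  classical
  obtain ⟨y, hyK, hmono, ha, hpred, hcov⟩ := exists_ray hunb
  have hdinj : ∀ n m, Q.d (y n) = Q.d (y m) → n = m := fun n m h => hmono.injective h
  have ha' : ∀ n, Q.a (Q.τ (y (n + 1))) (y n) = 1 := fun n => by rw [← Q.a_eq, ha]
  have hne : ∀ n m, n ≠ m + 1 → m ≠ n + 1 → ∀ z, (z = y n ∨ z = Q.τ (y n)) → Q.a z (y m) = 0 := by
    intro n m h1 h2 z hz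
    by_contra h0
    have hdz : Q.d z = Q.d (y n) := by
      rcases hz with rfl | rfl
      exacts [rfl, Q.d_τ _]
    rcases hpred m z h0 with h | ⟨l, rfl, h⟩
    · rw [h, Q.d_τ] at hdz
      exact h1 (hdinj _ _ hdz).symm
    · rw [h] at hdz
      exact h2 (by rw [hdinj _ _ hdz])
  -- If τ fixes one of two neighbours on the ray, there is an arrow to one of them whose source
  -- must, by comparing values of d, be both the other neighbour and its translate.
  have hfix : ∀ n, Q.τ (y n) = y n ↔ Q.τ (y (n + 1)) = y (n + 1) := by
    intro n
    constructor
    · intro h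
      have h1 : Q.a (y (n + 1)) (y n) ≠ 0 := by
        rw [← h, Q.a_τ_right, ha]; exact one_ne_zero
      rcases hpred n _ h1 with h2 | ⟨m, rfl, h2⟩
      · exact h2.symm
      · have := hdinj _ _ (congrArg Q.d h2)
        omega
    · intro h
      have h1 : Q.a (Q.τ (y n)) (y (n + 1)) ≠ 0 := by
        rw [← h, Q.a_τ_τ, ha]; exact one_ne_zero
      rcases hpred (n + 1) _ h1 with h2 | ⟨m, hm, h2⟩
      · have := congrArg Q.d h2
        rw [Q.d_τ, Q.d_τ] at this
        have := hdinj _ _ this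
        omega
      · obtain rfl : n = m := by omega
        exact h2
  by_cases h0 : Q.τ (y 0) = y 0
  · have hτ : ∀ n, Q.τ (y n) = y n := fun n => by
      induction n with
      | zero => exact h0
      | succ n ih => exact (hfix n).1 ih
    refine ⟨1, Or.inl rfl, Equiv.ofBijective (fun p => ⟨y p.1, hyK p.1⟩) ⟨?_, ?_⟩, ?_, ?_⟩
    · rintro ⟨n, i⟩ ⟨m, j⟩ h
      exact Prod.ext (hdinj _ _ (congrArg (fun z => Q.d z.1) h)) (Subsingleton.elim _ _)
    · rintro ⟨z, hz⟩
      obtain ⟨n, h⟩ := hcov z hz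
      rw [hτ, or_self] at h
      exact ⟨(n, 0), Subtype.ext h.symm⟩
    · rintro ⟨n, i⟩ ⟨m, j⟩
      obtain rfl := Subsingleton.elim i 0
      obtain rfl := Subsingleton.elim j 0
      change Q.a (y n) (y m) = _
      unfold tubeArrows
      split_ifs with h
      · rcases h with ⟨h, -⟩ | ⟨h, -⟩
        · obtain rfl : m = n + 1 := h
          exact ha n
        · obtain rfl : n = m + 1 := h
          rw [← hτ (m + 1)]; exact ha' m
      · refine hne n m (fun h1 => h (Or.inr ⟨h1, Subsingleton.elim _ _⟩))
          (fun h1 => h (Or.inl ⟨h1, Subsingleton.elim _ _⟩)) _ (Or.inl rfl)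
    · rintro ⟨n, i⟩
      exact hτ n
  · have hτ : ∀ n, Q.τ (y n) ≠ y n := fun n => by
      induction n with
      | zero => exact h0
      | succ n ih => exact fun h => ih ((hfix n).2 h)
    have hz2 : ∀ i : ZMod 2, i = 0 ∨ i = 1 := by decide
    let f : ℕ × ZMod 2 → V := fun p => if p.2 = 0 then y p.1 else Q.τ (y p.1)
    have hfd : ∀ p, Q.d (f p) = Q.d (y p.1) := by
      intro p
      simp only [f]
      split_ifs
      exacts [rfl, Q.d_τ _]
    have hfK : ∀ p, f p ∈ Q.comp x₀ := by
      intro p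
      simp only [f]
      split_ifs
      exacts [hyK _, τ_mem_comp hinf (hyK _)]
    have hfτ : ∀ n i, Q.τ (f (n, i)) = f (n, i + 1) := by
      intro n i
      rcases hz2 i with rfl | rfl
      · change Q.τ (y n) = Q.τ (y n)
        rfl
      · change Q.τ (Q.τ (y n)) = y n
        exact Q.τ_τ _
    have hbase : ∀ n i m, Q.a (f (n, i)) (y m) = tubeArrows 2 (n, i) (m, 0) := by
      intro n i m
      by_cases h1 : n = m + 1
      · subst h1
        rcases hz2 i with rfl | rfl
        · change Q.a (y (m + 1)) (y m) = _
          rw [show tubeArrows 2 (m + 1, (0 : ZMod 2)) (m, 0) = 0 by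
            simp [tubeArrows]; omega]
          by_contra h
          rcases hpred m _ h with h2 | ⟨l, rfl, h2⟩
          · exact hτ _ h2.symm
          · have := hdinj _ _ (congrArg Q.d h2)
            omega
        · change Q.a (Q.τ (y (m + 1))) (y m) = _
          rw [ha']
          simp [tubeArrows, show (0 : ZMod 2) = 1 + 1 from rfl]
      · by_cases h2 : m = n + 1
        · subst h2
          rcases hz2 i with rfl | rfl
          · change Q.a (y n) (y (n + 1)) = _
            rw [ha]
            simp [tubeArrows]
          · change Q.a (Q.τ (y n)) (y (n + 1)) = _
            rw [show tubeArrows 2 (n, (1 : ZMod 2)) (n + 1, 0) = 0 by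
              simp [tubeArrows]; omega]
            by_contra h
            rcases hpred (n + 1) _ h with h2 | ⟨l, hl, h2⟩
            · have := congrArg Q.d h2
              rw [Q.d_τ, Q.d_τ] at this
              have := hdinj _ _ this
              omega
            · obtain rfl : n = l := by omega
              exact hτ _ h2
        · rw [hne n m h1 h2]
          · simp [tubeArrows, h1, h2]
          · rcases hz2 i with rfl | rfl
            exacts [Or.inl rfl, Or.inr rfl]
    have htube : ∀ p q : ℕ × ZMod 2,
        tubeArrows 2 (p.1, p.2 + 1) (q.1, q.2 + 1) = tubeArrows 2 p q := by
      intro p q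
      simp [tubeArrows]
    refine ⟨2, Or.inr rfl, Equiv.ofBijective (fun p => ⟨f p, hfK p⟩) ⟨?_, ?_⟩, ?_, ?_⟩
    · rintro ⟨n, i⟩ ⟨m, j⟩ h
      have h' : f (n, i) = f (m, j) := congrArg Subtype.val h
      have hd := congrArg Q.d h'
      rw [hfd, hfd] at hd
      obtain rfl : n = m := hdinj _ _ hd
      rcases hz2 i with rfl | rfl <;> rcases hz2 j with rfl | rfl
      · rfl
      · exact (hτ n h'.symm).elim
      · exact (hτ n h').elim
      · rfl
    · rintro ⟨z, hz⟩
      obtain ⟨n, h | h⟩ := hcov z hz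
      exacts [⟨(n, 0), Subtype.ext h.symm⟩, ⟨(n, 1), Subtype.ext h.symm⟩]
    · rintro ⟨n, i⟩ ⟨m, j⟩
      change Q.a (f (n, i)) (f (m, j)) = _
      rcases hz2 j with rfl | rfl
      · exact hbase n i m
      · change Q.a (f (n, i)) (Q.τ (y m)) = _
        rw [← Q.a_τ_τ, Q.τ_τ, hfτ, hbase, ← htube (n, i)]
        rfl
    · rintro ⟨n, i⟩
      change Q.τ (f (n, i)) = f (n, i - 1)
      rw [hfτ]
      congr 2
      revert i
      decide

end SubadditiveQuiver

end Combinatorics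

end

/-! ### The Auslander–Reiten quiver -/

section

variable {k : Type w} [Field k] {C : Type u} [Category.{v} C] [Preadditive C] [Linear k C]
  [HasZeroObject C] [HasShift C ℤ] [∀ n : ℤ, (shiftFunctor C n).Additive] [Pretriangulated C]

lemma ARVertex.indecomposable (x : ARVertex C) : Indecomposable x.obj := x.2

lemma ARVertex.eq_of_iso {x y : ARVertex C} (e : x.obj ≅ y.obj) : x = y := by
  apply Subtype.ext
  rw [← toSkeleton_fromSkeleton_obj x.1, ← toSkeleton_fromSkeleton_obj y.1]
  exact congr_toSkeleton_of_iso e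

/-- The vertex of an indecomposable object. -/
noncomputable def toVertex (X : C) (hX : Indecomposable X) : ARVertex C :=
  ⟨toSkeleton X, hX.of_iso (fromSkeletonToSkeletonIso X).symm⟩

/-- The representative of the vertex of `X` is isomorphic to `X`. -/
noncomputable def toVertexIso (X : C) (hX : Indecomposable X) : (toVertex X hX).obj ≅ X :=
  fromSkeletonToSkeletonIso X

variable [IsIdempotentComplete C]

/-- The suspension as a permutation of the vertices of the Auslander–Reiten quiver. -/
noncomputable def translate (x : ARVertex C) : ARVertex C :=
  toVertex (x.obj⟦(1 : ℤ)⟧) (x.indecomposable.shift 1)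

/-- The representative of the translate is the suspension of the representative. -/
noncomputable def translateIso (x : ARVertex C) : x.obj⟦(1 : ℤ)⟧ ≅ (translate x).obj :=
  (toVertexIso _ _).symm

lemma exists_isARTriangle_vertex [IsAlgClosed k] (hfin : IsHomFinite k C)
    (hCY : IsTwoCalabiYau k C) (x : ARVertex C) :
    ∃ (E : C) (f : (translate x).obj ⟶ E) (g : E ⟶ x.obj)
      (h : x.obj ⟶ (translate x).obj⟦(1 : ℤ)⟧), IsARTriangle (Triangle.mk f g h) :=
  exists_isARTriangle hfin hCY x.indecomposable (translateIso x)

/-- One AR triangle ending at `y` starts at its suspension, and the last term determines the first.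
-/
lemma isTranslate_iff [IsAlgClosed k] (hfin : IsHomFinite k C) (hCY : IsTwoCalabiYau k C)
    (x y : ARVertex C) : IsTranslate x y ↔ x = translate y := by
  obtain ⟨E, f, g, h, hΔ⟩ := exists_isARTriangle_vertex hfin hCY y
  constructor
  · rintro ⟨Δ, hΔ', ⟨e₁⟩, ⟨e₃⟩⟩
    obtain ⟨e⟩ := hΔ'.nonempty_iso₁ hfin hΔ e₃
    exact ARVertex.eq_of_iso (e₁.symm ≪≫ e)
  · rintro rfl
    exact ⟨_, hΔ, ⟨Iso.refl _⟩, ⟨Iso.refl _⟩⟩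

lemma arrows_eq_arrows_translate [IsAlgClosed k] (hfin : IsHomFinite k C)
    (hCY : IsTwoCalabiYau k C) (x y : ARVertex C) :
    arrows k x y = arrows k (translate y) x := by
  obtain ⟨E, f, g, h, hΔ⟩ := exists_isARTriangle_vertex hfin hCY y
  exact hΔ.irrDim_eq hfin x.indecomposable

/-- Every object is a finite direct sum of representatives of vertices. -/
lemma exists_vertex_decomposition (hfin : IsHomFinite k C) (X : C) :
    ∃ (ι : Type) (_ : Fintype ι) (x : ι → ARVertex C) (i : ∀ j, (x j).obj ⟶ X)
      (p : ∀ j, X ⟶ (x j).obj), (∀ j, i j ≫ p j = 𝟙 _) ∧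
      (∀ j l, j ≠ l → i j ≫ p l = 0) ∧ ∑ j, p j ≫ i j = 𝟙 X := by
  obtain ⟨ι, _, Y, i, p, hY, h1, h2, h3⟩ := exists_indecomposable_decomposition hfin X
  refine ⟨ι, inferInstance, fun j => toVertex (Y j) (hY j),
    fun j => (toVertexIso _ (hY j)).hom ≫ i j, fun j => p j ≫ (toVertexIso _ (hY j)).inv,
    fun j => ?_, fun j l hjl => ?_, ?_⟩
  · simp [reassoc_of% (h1 j)]
  · simp [reassoc_of% (h2 j l hjl)]
  · simpa using h3

/-- An indecomposable retract of a direct sum is one of the summands. -/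
lemma exists_eq_of_isSplitEpi (hfin : IsHomFinite k C) {X : C} {ι : Type*} [Fintype ι]
    {x : ι → ARVertex C} {i : ∀ j, (x j).obj ⟶ X} {p : ∀ j, X ⟶ (x j).obj}
    (h : ∑ j, p j ≫ i j = 𝟙 X) {y : ARVertex C} (f : X ⟶ y.obj) (hf : IsSplitEpi f) :
    ∃ j, y = x j := by
  have := hfin y.obj y.obj
  have hsum : ∑ j, section_ f ≫ p j ≫ i j ≫ f = 𝟙 y.obj := by
    rw [← IsSplitEpi.id f]
    have := congrArg (fun g => section_ f ≫ g ≫ f) h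
    simpa [Preadditive.comp_sum, Preadditive.sum_comp] using this
  obtain ⟨j, -, hj⟩ := y.indecomposable.exists_isIso_of_sum (k := k) Finset.univ
    (fun j => section_ f ≫ p j ≫ i j ≫ f) (by rw [hsum]; infer_instance)
  refine ⟨j, ?_⟩
  have hr : (section_ f ≫ p j) ≫ (i j ≫ f) ≫ inv (section_ f ≫ p j ≫ i j ≫ f) = 𝟙 _ := by
    refine Eq.trans ?_ (IsIso.hom_inv_id (section_ f ≫ p j ≫ i j ≫ f))
    simp only [Category.assoc]
  have := (y.indecomposable.isIso_of_retract (x j).indecomposable hr).1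
  exact ARVertex.eq_of_iso (asIso (section_ f ≫ p j))

/-- The number of maps modulo radical maps from an indecomposable object into a direct sum is at
most its multiplicity as a summand. -/
lemma finrank_quotient_rad_le_card [IsAlgClosed k] (hfin : IsHomFinite k C) {X : C} {ι : Type*}
    [Fintype ι] [DecidableEq (ARVertex C)]
    {x : ι → ARVertex C} {i : ∀ j, (x j).obj ⟶ X} {p : ∀ j, X ⟶ (x j).obj}
    (h : ∑ j, p j ≫ i j = 𝟙 X) (y : ARVertex C) :
    Module.finrank k ((y.obj ⟶ X) ⧸ rad k y.obj X) ≤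
      (Finset.univ.filter fun j => x j = y).card := by
  have := hfin y.obj X
  have := hfin y.obj y.obj
  have hL : ∀ j : {j // x j = y}, ∃ L : (y.obj ⟶ X) →ₗ[k] k,
      ∀ f, L f = 0 → IsRadical (f ≫ p j.1) := by
    rintro ⟨j, rfl⟩
    obtain ⟨ε, -, hε⟩ := (x j).indecomposable.exists_residue (k := k)
    exact ⟨ε.comp (Linear.rightComp k _ (p j)), fun f hf => (hε _).1 hf⟩
  choose L hL using hL
  -- Only residues at summands equal to y matter: components into other indecomposables are
  -- automatically radical.
  let Φ : (y.obj ⟶ X) →ₗ[k] ({j // x j = y} → k) := LinearMap.pi L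
  have hker : LinearMap.ker Φ ≤ rad k y.obj X := by
    intro f hf
    have hrad : ∀ j, f ≫ p j ∈ rad k y.obj (x j).obj := by
      intro j
      by_cases hj : x j = y
      · exact hL ⟨j, hj⟩ f (congrFun (LinearMap.mem_ker.1 hf) ⟨j, hj⟩)
      · refine (y.indecomposable.isRadical_iff_not_isIso (k := k)
          (x j).indecomposable _).2 fun hi => hj ?_
        exact (ARVertex.eq_of_iso (asIso (f ≫ p j))).symm
    have hf' : f = ∑ j, (f ≫ p j) ≫ i j := by
      simp only [Category.assoc]
      rw [← Preadditive.comp_sum, h, Category.comp_id]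
    rw [hf']
    exact Submodule.sum_mem _ fun j _ => (hrad j).postcomp (i j)
  have h1 := Submodule.finrank_quotient_add_finrank (rad k y.obj X)
  have h2 := Φ.finrank_range_add_finrank_ker
  have h3 := Submodule.finrank_mono hker
  have h4 := Submodule.finrank_le (LinearMap.range Φ)
  rw [Module.finrank_fintype_fun_eq_card, Fintype.card_subtype] at h4
  omega

/-- The middle term of the Auslander–Reiten triangle ending in `y`, as a direct sum of
representatives of vertices. -/
lemma exists_mesh [IsAlgClosed k] [DecidableEq (ARVertex C)] (hfin : IsHomFinite k C)
    (hCY : IsTwoCalabiYau k C) (y : ARVertex C) :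
    ∃ (ι : Type) (_ : Fintype ι) (x : ι → ARVertex C) (g : ∀ j, (x j).obj ⟶ y.obj),
      (∀ z, arrows k z y ≤ (Finset.univ.filter fun j => x j = z).card) ∧
      (∀ j, arrows k (x j) y ≠ 0) ∧ (∀ j, IsRadical (g j)) ∧
      (∀ (W : C) (f : W ⟶ y.obj), ¬ IsSplitEpi f →
        ∃ f' : ∀ j, W ⟶ (x j).obj, f = ∑ j, f' j ≫ g j) ∧
      (∀ P : C, ∑ j, Module.finrank k (P ⟶ (x j).obj) ≤
        Module.finrank k (P ⟶ (translate y).obj) + Module.finrank k (P ⟶ y.obj)) := by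
  obtain ⟨E, f, g, h, hΔ⟩ := exists_isARTriangle_vertex hfin hCY y
  obtain ⟨ι, _, x, i, p, hip, hort, hsum⟩ := exists_vertex_decomposition hfin E
  have harr : ∀ z, arrows k z y = Module.finrank k ((z.obj ⟶ E) ⧸ rad k z.obj E) :=
    fun z => hΔ.irrDim_obj₃ hfin z.obj
  refine ⟨ι, inferInstance, x, fun j => i j ≫ g, fun z => ?_, fun j => ?_, fun j => ?_,
    fun W t ht => ?_, fun P => ?_⟩
  · rw [harr]
    exact finrank_quotient_rad_le_card hfin hsum z
  · rw [harr]
    have := hfin (x j).obj E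
    have := hfin (x j).obj (x j).obj
    intro h0
    have hsub := Module.finrank_zero_iff.1 h0
    have htop := Submodule.Quotient.subsingleton_iff.1 hsub
    have hrad : IsRadical (i j) := by
      change i j ∈ rad k (x j).obj E
      rw [htop]; trivial
    exact ((x j).indecomposable.isRadical_iff_not_isSplitMono (k := k) _).1 hrad
      ⟨⟨⟨p j, hip j⟩⟩⟩
  · exact (hΔ.isRadical₂ hfin).precomp (i j)
  · obtain ⟨t', ht'⟩ := hΔ.factors W t ht
    change W ⟶ E at t'
    change t' ≫ g = t at ht'
    refine ⟨fun j => t' ≫ p j, ?_⟩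
    rw [← ht']
    have := congrArg (fun a => t' ≫ a ≫ g) hsum
    simpa [Preadditive.comp_sum, Preadditive.sum_comp] using this.symm
  · refine le_trans ?_ (finrank_hom_le_of_distTriang hfin hΔ.distinguished P)
    change _ ≤ Module.finrank k (P ⟶ E)
    have := fun j => hfin P (x j).obj
    have := hfin P E
    rw [← Module.finrank_pi_fintype k]
    let Φ : (P ⟶ E) →ₗ[k] (∀ j, P ⟶ (x j).obj) :=
      LinearMap.pi fun j => Linear.rightComp k P (p j)
    have hΦ : Function.Surjective Φ := by
      classical
      intro a
      refine ⟨∑ j, a j ≫ i j, funext fun l => ?_⟩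
      change (∑ j, a j ≫ i j) ≫ p l = a l
      rw [Preadditive.sum_comp, Finset.sum_eq_single l]
      · rw [Category.assoc, hip, Category.comp_id]
      · intro j _ hj
        rw [Category.assoc, hort j l hj, comp_zero]
      · simp
    exact LinearMap.finrank_le_finrank_of_surjective hΦ

/-- Vertices reachable by at most `n` arrows from a direct summand of `T`. -/
def reachable (k : Type w) [Field k] [Linear k C] (T : C) : ℕ → Set (ARVertex C)
  | 0 => {x | ∃ f : T ⟶ x.obj, IsSplitEpi f}
  | n + 1 => reachable k T n ∪ {y | ∃ z ∈ reachable k T n, arrows k z y ≠ 0}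

lemma finite_predecessors [IsAlgClosed k] (hfin : IsHomFinite k C) (hCY : IsTwoCalabiYau k C)
    (y : ARVertex C) : {z | arrows k z y ≠ 0}.Finite := by
  classical
  obtain ⟨ι, _, x, g, hcard, -⟩ := exists_mesh hfin hCY y
  refine (Set.finite_range x).subset fun z hz => ?_
  by_contra hcon
  refine hz (Nat.le_zero.1 ((hcard z).trans (Nat.le_zero.2 ?_)))
  rw [Finset.card_eq_zero, Finset.filter_eq_empty_iff]
  exact fun j _ hj => hcon ⟨j, hj⟩

/-- A map from `T` to a vertex that is not reached in `n` steps is a combination of maps that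
factor through a chain of `n` radical maps. -/
lemma mem_span_of_notMem_reachable [IsAlgClosed k] (hfin : IsHomFinite k C)
    (hCY : IsTwoCalabiYau k C) (T : C) {P : C → Prop} {K : Set (ARVertex C)}
    (hK : ∀ y ∈ K, ∀ z, arrows k z y ≠ 0 → z ∈ K) (hP : ∀ y ∈ K, P y.obj) (n : ℕ)
    {y : ARVertex C} (hy : y ∈ K) (hyn : y ∉ reachable k T n) (t : T ⟶ y.obj) :
    t ∈ Submodule.span k {s | ∃ (Z : C) (a : T ⟶ Z) (b : Z ⟶ y.obj),
      IsRadicalChain P n b ∧ s = a ≫ b} := by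
  classical
  induction n generalizing y with
  | zero =>
    exact Submodule.subset_span ⟨_, t, 𝟙 _, ⟨hP y hy, hP y hy⟩, by simp⟩
  | succ n ih =>
    have hbase : ∀ m, (reachable k T 0 : Set (ARVertex C)) ⊆ reachable k T m := by
      intro m
      induction m with
      | zero => exact subset_rfl
      | succ m ih' => exact ih'.trans Set.subset_union_left
    -- `t` therefore factors through the mesh ending in y, whose summands are not reached in `n`
    -- steps; induction applies to them and each mesh map adds one radical factor.
    have hns : ¬ IsSplitEpi t := fun hs => hyn (hbase _ ⟨t, hs⟩)
    obtain ⟨ι, _, x, g, -, harr, hrad, hfac, -⟩ := exists_mesh hfin hCY y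
    obtain ⟨t', rfl⟩ := hfac T t hns
    refine Submodule.sum_mem _ fun j _ => ?_
    have hj := ih (hK y hy _ (harr j)) (fun h => hyn (Or.inr ⟨x j, h, harr j⟩)) (t' j)
    have hmap : Submodule.span k {s | ∃ (Z : C) (a : T ⟶ Z) (b : Z ⟶ (x j).obj),
        IsRadicalChain P n b ∧ s = a ≫ b} ≤ (Submodule.span k {s | ∃ (Z : C) (a : T ⟶ Z)
        (b : Z ⟶ y.obj), IsRadicalChain P (n + 1) b ∧ s = a ≫ b}).comap
        (Linear.rightComp k T (g j)) := by
      rw [Submodule.span_le]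
      rintro _ ⟨Z, a, b, hb, rfl⟩
      refine Submodule.subset_span ⟨Z, a, b ≫ g j, ⟨hP y hy, _, b, g j, hb, hrad j, rfl⟩, ?_⟩
      exact Category.assoc _ _ _
    exact hmap hj

/-! ### The subadditive function on the Auslander–Reiten quiver and its unboundedness -/

variable [∀ n : ℤ, (shiftFunctor C n).Linear k]

/-- The Auslander–Reiten quiver with the subadditive function `dim Hom(T ⊕ T⟦1⟧, -)`. -/
noncomputable def arQuiver [IsAlgClosed k] (hfin : IsHomFinite k C) (hCY : IsTwoCalabiYau k C)
    {T : C} (hT : IsClusterTilting T) (hsymm : IsSymmetricAlgebra k (End T)) :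
    SubadditiveQuiver (ARVertex C) where
  a := arrows k
  τ := translate
  d x := totalDim k T x.obj
  τ_τ x := by
    obtain ⟨e⟩ := hT.nonempty_iso_shift_two hfin hCY hsymm x.obj
    exact ARVertex.eq_of_iso ((translateIso _).symm ≪≫
      (shiftFunctor C (1 : ℤ)).mapIso (translateIso x).symm ≪≫
      ((shiftFunctorAdd' C (1 : ℤ) 1 2 (by norm_num)).app x.obj).symm ≪≫ e.symm)
  a_eq := arrows_eq_arrows_translate hfin hCY
  d_pos x := hT.totalDim_pos hfin hCY hsymm x.indecomposable
  d_τ x := by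
    rw [← hT.totalDim_shift hfin hCY hsymm x.obj, totalDim_congr T (translateIso x)]
  sum_le y S := by
    classical
    obtain ⟨ι, _, x, g, hcard, -, -, -, hdim⟩ := exists_mesh hfin hCY y
    have hτ : totalDim k T (translate y).obj = totalDim k T y.obj := by
      rw [← hT.totalDim_shift hfin hCY hsymm y.obj, totalDim_congr T (translateIso y)]
    -- Add the mesh inequalities for P = T and P = T⟦1⟧; τ-invariance turns d(τy) + d(y) into 2
    -- d(y).
    have h1 : ∑ j, totalDim k T (x j).obj ≤ 2 * totalDim k T y.obj := by
      have e1 := hdim T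
      have e2 := hdim (T⟦(1 : ℤ)⟧)
      rw [totalDim, totalDim] at hτ
      simp only [totalDim, Finset.sum_add_distrib]
      omega
    refine le_trans ?_ h1
    calc ∑ z ∈ S, arrows k z y * totalDim k T z.obj
        ≤ ∑ z ∈ S, ∑ j, if x j = z then totalDim k T z.obj else 0 := by
          refine Finset.sum_le_sum fun z _ => ?_
          rw [← Finset.sum_filter, Finset.sum_const, smul_eq_mul]
          exact Nat.mul_le_mul_right _ (hcard z)
      _ = ∑ j, ∑ z ∈ S, if x j = z then totalDim k T z.obj else 0 := Finset.sum_comm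
      _ ≤ ∑ j, totalDim k T (x j).obj := by
          refine Finset.sum_le_sum fun j _ => ?_
          rw [Finset.sum_ite_eq]
          split_ifs <;> simp

/-- `T` has finitely many indecomposable summands, and the successors of z are translates of its
finitely many predecessors. -/
lemma IsClusterTilting.finite_reachable [IsAlgClosed k] (hfin : IsHomFinite k C)
    (hCY : IsTwoCalabiYau k C) {T : C} (hT : IsClusterTilting T)
    (hsymm : IsSymmetricAlgebra k (End T)) (n : ℕ) :
    (reachable k T n : Set (ARVertex C)).Finite := by
  induction n with
  | zero =>
    obtain ⟨ι, _, x, i, p, -, -, hsum⟩ := exists_vertex_decomposition hfin T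
    refine (Set.finite_range x).subset ?_
    rintro y ⟨f, hf⟩
    obtain ⟨j, rfl⟩ := exists_eq_of_isSplitEpi hfin hsum f hf
    exact ⟨j, rfl⟩
  | succ n ih =>
    refine ih.union ((ih.biUnion fun z _ =>
      (finite_predecessors (k := k) hfin hCY z).image translate).subset ?_)
    rintro y ⟨z, hz, hzy⟩
    refine Set.mem_biUnion hz ⟨translate y, ?_, (arQuiver hfin hCY hT hsymm).τ_τ y⟩
    change arrows k (translate y) z ≠ 0
    rwa [← arrows_eq_arrows_translate hfin hCY]

/-- On an infinite component the function `dim Hom(T ⊕ T⟦1⟧, -)` is unbounded. -/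
lemma unbounded_of_infinite [IsAlgClosed k] (hfin : IsHomFinite k C) (hCY : IsTwoCalabiYau k C)
    {T : C} (hT : IsClusterTilting T) (hsymm : IsSymmetricAlgebra k (End T)) {x : ARVertex C}
    (hinf : (component k x).Infinite) (b : ℕ) :
    ∃ y ∈ component k x, b < totalDim k T y.obj := by
  by_contra! hb
  let Q := arQuiver hfin hCY hT hsymm
  have hK : ∀ y ∈ component k x, ∀ z, arrows k z y ≠ 0 → z ∈ component k x :=
    fun y hy z hz => SubadditiveQuiver.mem_comp_of_arrow' (Q := Q) hy hz
  have hzero : ∀ y ∈ component k x, y ∉ reachable k T (2 ^ b - 1) →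
      Module.finrank k (T ⟶ y.obj) = 0 := by
    intro y hy hyn
    have h0 : ∀ t : T ⟶ y.obj, t = 0 := by
      intro t
      have ht := mem_span_of_notMem_reachable hfin hCY T
        (P := fun Z => Indecomposable Z ∧ Module.finrank k (T ⟶ Z) ≤ b) hK
        (fun z hz => ⟨z.indecomposable, (Nat.le_add_right _ _).trans (hb z hz)⟩)
        (2 ^ b - 1) hy hyn t
      have hbot : Submodule.span k {s | ∃ (Z : C) (a : T ⟶ Z) (c : Z ⟶ y.obj),
          IsRadicalChain (fun Z => Indecomposable Z ∧ Module.finrank k (T ⟶ Z) ≤ b)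
            (2 ^ b - 1) c ∧ s = a ≫ c} ≤ ⊥ := by
        rw [Submodule.span_le]
        rintro _ ⟨Z, a, c, hc, rfl⟩
        -- With m = b the Harada–Sai bound is b - b = 0.
        have hr := hT.finrank_range_le_of_isRadicalChain hfin b b c hc
        have := hfin T y.obj
        rw [Nat.sub_self, Nat.le_zero, Submodule.finrank_eq_zero] at hr
        have : Linear.rightComp k T c a ∈ LinearMap.range (Linear.rightComp k T c) := ⟨a, rfl⟩
        rwa [hr] at this
      exact hbot ht
    have : Subsingleton (T ⟶ y.obj) := ⟨fun f g => by rw [h0 f, h0 g]⟩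
    exact Module.finrank_zero_of_subsingleton
  have hR := hT.finite_reachable hfin hCY hsymm (2 ^ b - 1)
  -- Outside this finite set neither y nor τy receives a nonzero map from T, so both summands of
  -- d(y) vanish.
  refine hinf ((hR.union (hR.image translate)).subset fun y hy => ?_)
  by_contra hcon
  rw [Set.mem_union, not_or] at hcon
  have hτ : translate y ∈ component k x :=
    SubadditiveQuiver.τ_mem_comp (Q := Q) (x₀ := x) hinf hy
  have h1 := hzero y hy hcon.1
  have h2 := hzero _ hτ fun h => hcon.2 ⟨_, h, Q.τ_τ y⟩
  rw [← (Linear.homCongr k (Iso.refl T) (translateIso y)).finrank_eq,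
    hT.finrank_hom_shift hfin hCY hsymm] at h2
  have := hT.totalDim_pos hfin hCY hsymm y.indecomposable
  rw [totalDim, h1, h2] at this
  exact lt_irrefl _ this

end

end ARTheory


/-! ### The main theorem -/

theorem mainTheorem4 {k : Type*} [Field k] [IsAlgClosed k] {C : Type*} [Category C]
    [Preadditive C] [Linear k C] [HasZeroObject C] [HasShift C ℤ]
    [∀ n : ℤ, (shiftFunctor C n).Additive] [∀ n : ℤ, (shiftFunctor C n).Linear k]
    [Pretriangulated C] [IsTriangulated C] [IsIdempotentComplete C]
    (hfin : ARTheory.IsHomFinite k C) (hCY : ARTheory.IsTwoCalabiYau k C)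
    (T : C) (hT : ARTheory.IsClusterTilting T)
    (hsymm : ARTheory.IsSymmetricAlgebra k (End T)) :
    (∀ x : ARTheory.ARVertex C,
      ∃ y : ARTheory.ARVertex C, ARTheory.IsTranslate y x ∧ ARTheory.IsTranslate x y) ∧
    ∀ x : ARTheory.ARVertex C, (ARTheory.component k x).Infinite →
      ARTheory.IsStableTube k 1 (ARTheory.component k x) ∨
        ARTheory.IsStableTube k 2 (ARTheory.component k x) := by
  let Q := ARTheory.arQuiver hfin hCY hT hsymm
  have htr := ARTheory.isTranslate_iff hfin hCY
  refine ⟨fun x => ⟨Q.τ x, (htr _ _).2 rfl, (htr _ _).2 (Q.τ_τ x).symm⟩, fun x hinf => ?_⟩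
  obtain ⟨r, hr, e, he, heτ⟩ := ARTheory.SubadditiveQuiver.exists_tube (Q := Q) (x₀ := x) hinf
    (ARTheory.unbounded_of_infinite hfin hCY hT hsymm hinf)
  have htube : ARTheory.IsStableTube k r (ARTheory.component k x) := by
    refine ⟨by rcases hr with rfl | rfl <;> norm_num, e, he, fun p q => ?_⟩
    rw [htr]
    change (e p).1 = Q.τ (e q).1 ↔ _
    rw [heτ, Subtype.val_inj, e.apply_eq_iff_eq]
  rcases hr with rfl | rfl
  exacts [Or.inl htube, Or.inr htube]
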